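/- Let $\mathcal V$ be a finite-dimensional complex inner product space, let $L(\mathcal V)$ be the space of linear operators on $\mathcal V$, and let $\Psi : L(\mathcal V)\to L(\mathcal V)$ be a completely positive trace-preserving linear map. Then there exist an integer $n\ge 0$, finite-dimensional complex inner product spaces $\mathcal Y_1,\dots,\mathcal Y_n$ and $\mathcal Z_1,\dots,\mathcal Z_n$, and, for every $i\in\{1,\dots,n\}$, a density operator $\rho_i$ on $\mathcal Z_i$ (positive semi-definite, trace $1$) of rank $\dim\mathcal Z_i$, such that \[ \bigoplus_{i=1}^n \mathcal Y_i\otimes\mathcal Z_i\subseteq\mathcal V \] (that is, the spaces $\mathcal Y_i\otimes\mathcal Z_i$ are isometrically embedded in $\mathcal V$ as mutually orthogonal subspaces) and the fixed space of $\Psi$ is \[ \{\mu\in L(\mathcal V):\Psi(\mu)=\mu\}=\bigoplus_{i=1}^n L(\mathcal Y_i)\otimes\rho_i , \] where $L(\mathcal Y_i)\otimes\rho_i=\{A\otimes\rho_i : A\in L(\mathcal Y_i)\}$ and operators on $\mathcal Y_i\otimes\mathcal Z_i$ are regarded as operators on $\mathcal V$ that vanish on the orthogonal complement of $\mathcal Y_i\otimes\mathcal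 Z_i$. -/

import Mathlib

open scoped TensorProduct

noncomputable section

/-- A super-operator on `L(V)`: a linear map from `L(V)` to itself. -/
abbrev SuperOp (V : Type*) [AddCommGroup V] [Module ℂ V] :=
  (V →ₗ[ℂ] V) →ₗ[ℂ] (V →ₗ[ℂ] V)

/-- The fixed space of a super-operator, as a linear subspace of `L(V)`. -/
def fixedSpace {V : Type*} [AddCommGroup V] [Module ℂ V] (Ψ : SuperOp V) :
    Submodule ℂ (V →ₗ[ℂ] V) where
  carrier := {μ | Ψ μ = μ}
  add_mem' := fun {a b} ha hb => by
    have ha' : Ψ a = a := ha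
    have hb' : Ψ b = b := hb
    show Ψ (a + b) = a + b
    rw [map_add, ha', hb']
  zero_mem' := map_zero Ψ
  smul_mem' := fun c a ha => by
    have ha' : Ψ a = a := ha
    show Ψ (c • a) = c • a
    rw [map_smul, ha']

/-- `Ψ` preserves the trace. -/
def IsTracePreserving {V : Type*} [AddCommGroup V] [Module ℂ V] (Ψ : SuperOp V) : Prop :=
  ∀ μ : V →ₗ[ℂ] V, LinearMap.trace ℂ V (Ψ μ) = LinearMap.trace ℂ V μ

/-- `Ψ` is positive: it maps Hermitian operators to Hermitian operators and positive
semi-definite operators to positive semi-definite operators. -/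
structure IsPositiveSuperOp {V : Type*} [NormedAddCommGroup V] [InnerProductSpace ℂ V]
    (Ψ : SuperOp V) : Prop where
  map_isSymmetric : ∀ μ : V →ₗ[ℂ] V, μ.IsSymmetric → (Ψ μ).IsSymmetric
  map_isPositive : ∀ μ : V →ₗ[ℂ] V, μ.IsPositive → (Ψ μ).IsPositive

/-- The super-operator `Ψ ⊗ 𝕀` on `L(V ⊗ Y)`, where `𝕀` is the identity super-operator
on `L(Y)` and `L(V) ⊗ L(Y)` is identified with `L(V ⊗ Y)` in the canonical way. -/
def ampliation {V : Type*} [AddCommGroup V] [Module ℂ V] [FiniteDimensional ℂ V]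
    (Y : Type*) [AddCommGroup Y] [Module ℂ Y] [FiniteDimensional ℂ Y] (Ψ : SuperOp V) :
    SuperOp (V ⊗[ℂ] Y) :=
  (homTensorHomEquiv ℂ V Y V Y).toLinearMap ∘ₗ
    TensorProduct.map Ψ LinearMap.id ∘ₗ (homTensorHomEquiv ℂ V Y V Y).symm.toLinearMap

/-- `Ψ` is completely positive: it is positive, and so is `Ψ ⊗ 𝕀` on `L(V ⊗ Y)` for every
complex Euclidean space `Y` (up to isometry, `Y = ℂᵏ`). -/
structure IsCompletelyPositive {V : Type*} [NormedAddCommGroup V] [InnerProductSpace ℂ V]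
    [FiniteDimensional ℂ V] (Ψ : SuperOp V) : Prop where
  isPositive : IsPositiveSuperOp Ψ
  isPositive_ampliation :
    ∀ k : ℕ, IsPositiveSuperOp (ampliation (EuclideanSpace ℂ (Fin k)) Ψ)

/-- `Ψ` is completely positive and trace-preserving (CPTP). -/
structure IsCPTP {V : Type*} [NormedAddCommGroup V] [InnerProductSpace ℂ V]
    [FiniteDimensional ℂ V] (Ψ : SuperOp V) : Prop where
  isCompletelyPositive : IsCompletelyPositive Ψ
  isTracePreserving : IsTracePreserving Ψ

/-- `ρ` is a density operator: positive semi-definite with trace `1`. -/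
structure IsDensityOperator {Z : Type*} [NormedAddCommGroup Z] [InnerProductSpace ℂ Z]
    (ρ : Z →ₗ[ℂ] Z) : Prop where
  isPositive : ρ.IsPositive
  trace_eq_one : LinearMap.trace ℂ Z ρ = 1

/-- For an isometric embedding `W` of `Y ⊗ Z` into `V` and an operator `ρ` on `Z`, the subspace
`L(Y) ⊗ ρ = {A ⊗ ρ : A ∈ L(Y)}` of `L(Y ⊗ Z)`, viewed as a subspace of `L(V)`: an operator `B`
on `Y ⊗ Z` is viewed as the operator `W B W*`, which acts as `B` on the copy of `Y ⊗ Z` inside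
`V` and as zero on its orthogonal complement. -/
def blockSpace {V Y Z : Type*} [NormedAddCommGroup V] [InnerProductSpace ℂ V]
    [FiniteDimensional ℂ V] [NormedAddCommGroup Y] [InnerProductSpace ℂ Y]
    [FiniteDimensional ℂ Y] [NormedAddCommGroup Z] [InnerProductSpace ℂ Z]
    [FiniteDimensional ℂ Z] (W : (Y ⊗[ℂ] Z) →ₗᵢ[ℂ] V) (ρ : Z →ₗ[ℂ] Z) :
    Submodule ℂ (V →ₗ[ℂ] V) where
  carrier := {μ | ∃ A : Y →ₗ[ℂ] Y,
    μ = W.toLinearMap ∘ₗ TensorProduct.map A ρ ∘ₗ LinearMap.adjoint W.toLinearMap}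
  add_mem' := by
    rintro _ _ ⟨A, rfl⟩ ⟨B, rfl⟩
    exact ⟨A + B, by
      rw [TensorProduct.map_add_left, LinearMap.add_comp, LinearMap.comp_add]⟩
  zero_mem' := ⟨0, by
    rw [TensorProduct.map_zero_left, LinearMap.zero_comp, LinearMap.comp_zero]⟩
  smul_mem' := by
    rintro c _ ⟨A, rfl⟩
    exact ⟨c • A, by
      rw [TensorProduct.map_smul_left, LinearMap.smul_comp, LinearMap.comp_smul]⟩

end

/-! Complete positivity gives a Kraus form `Ψ X = ∑ K a X (K a)*` (Choi), and trace preservation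
says `∑ (K a)* K a = 1`.

The positive and negative parts of a Hermitian fixed point are again fixed
(`krausMap_fixed_of_eq_sub`), so a positive fixed point `σ` of minimal kernel has a support carrying
every fixed point. That support is invariant under the `K a`, and restricting to it gives a channel
with Kraus operators `L a` and an invertible positive fixed point (`exists_faithful_restriction`).

With an invertible fixed point `σ`, every fixed point is `x σ` with `x` commuting with all `L a` and
`(L a)*` (`exists_commute_of_fixed`): the trace of the positive operator `∑ [x, L a] σ [x, L a]*`
vanishes.

The family of the `L a` and `(L a)*` is closed under adjoints, so the space is an orthogonal sum of
isotypic components `Y i ⊗ Z i` on which `L a` acts as `1 ⊗ M i a` and, by Schur's lemma, the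
commutant acts as `A i ⊗ 1` (`exists_isotypic_decomposition`). Compressing `σ` to a slice `e ⊗ Z i`
and normalising gives an invertible density operator `ρ i` fixed by the channel of the `M i a`. Then
`τ = ⨁ 1 ⊗ ρ i` is another invertible fixed point, and applying the commutation result to `τ` in
place of `σ` writes every fixed point as `x τ = ⨁ A i ⊗ ρ i`. -/

open scoped ComplexOrder InnerProductSpace

universe u

/-! ### Positive operators and vanishing traces. -/

section Positive

variable {V : Type*} [NormedAddCommGroup V] [InnerProductSpace ℂ V] [FiniteDimensional ℂ V]

/-- Spectral theorem, with each eigenvector scaled by the square root of its eigenvalue. It serves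
in place of an operator square root, and its vectors become Kraus operators when applied to the Choi
operator. -/
theorem LinearMap.IsPositive.exists_eq_sum_inner_smul {A : V →ₗ[ℂ] V} (hA : A.IsPositive) :
    ∃ c : Fin (Module.finrank ℂ V) → V, ∀ x, A x = ∑ a, ⟪c a, x⟫_ℂ • c a := by
  set u := hA.isSymmetric.eigenvectorBasis rfl with hu
  set l := hA.isSymmetric.eigenvalues rfl with hl
  have hl0 : ∀ a, 0 ≤ l a := hA.nonneg_eigenvalues rfl
  refine ⟨fun a => ((Real.sqrt (l a) : ℝ) : ℂ) • u a, fun x => ?_⟩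
  conv_lhs => rw [← u.sum_repr' x, map_sum]
  refine Finset.sum_congr rfl fun a _ => ?_
  rw [map_smul, hA.isSymmetric.apply_eigenvectorBasis, inner_smul_left, smul_smul, smul_smul]
  congr 1
  have : ((l a : ℝ) : ℂ) = (Real.sqrt (l a) : ℂ) * (Real.sqrt (l a) : ℂ) := by
    rw [← Complex.ofReal_mul, Real.mul_self_sqrt (hl0 a)]
  simp only [Complex.conj_ofReal]
  change _ * ((l a : ℝ) : ℂ) = _
  rw [this]; ring

/-- `⟪x, A x⟫` is the sum of the squares `|⟪c a, x⟫|²`, so its vanishing kills every coefficient of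
`A x`. -/
theorem LinearMap.IsPositive.apply_eq_zero_of_inner {A : V →ₗ[ℂ] V} (hA : A.IsPositive) {x : V}
    (hx : ⟪x, A x⟫_ℂ = 0) : A x = 0 := by
  obtain ⟨c, hc⟩ := hA.exists_eq_sum_inner_smul
  have h : ∑ a, ⟪c a, x⟫_ℂ * ⟪x, c a⟫_ℂ = 0 := by
    rw [← hx, hc x, inner_sum]
    exact Finset.sum_congr rfl fun a _ => by rw [inner_smul_right]
  have h0 : ∀ a, ⟪c a, x⟫_ℂ = 0 := by
    intro a
    have hn : ∀ b ∈ Finset.univ, (0 : ℂ) ≤ ⟪c b, x⟫_ℂ * ⟪x, c b⟫_ℂ := fun b _ => by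
      rw [← inner_conj_symm x (c b)]; exact mul_star_self_nonneg (⟪c b, x⟫_ℂ)
    have := (Finset.sum_eq_zero_iff_of_nonneg hn).1 h a (Finset.mem_univ a)
    rcases mul_eq_zero.1 this with h | h
    · exact h
    · exact inner_eq_zero_symm.1 h
  rw [hc x]
  simp [h0]

theorem LinearMap.IsPositive.eq_zero_of_trace {A : V →ₗ[ℂ] V} (hA : A.IsPositive)
    (h : LinearMap.trace ℂ V A = 0) : A = 0 := by
  set b := stdOrthonormalBasis ℂ V
  rw [LinearMap.trace_eq_sum_inner A b] at h
  have h0 := (Finset.sum_eq_zero_iff_of_nonneg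
    (fun i _ => hA.inner_nonneg_right (b i))).1 h
  refine b.toBasis.ext fun i => ?_
  simpa using hA.apply_eq_zero_of_inner (h0 i (Finset.mem_univ i))

theorem LinearMap.IsPositive.mul_star_eq_zero {A : V →ₗ[ℂ] V} (hA : A.IsPositive)
    (B : V →ₗ[ℂ] V) (h : B * A * star B = 0) : A * star B = 0 := by
  refine LinearMap.ext fun x => ?_
  refine hA.apply_eq_zero_of_inner (x := star B x) ?_
  have : ⟪x, (B * A * star B) x⟫_ℂ = 0 := by rw [h]; simp
  rw [LinearMap.star_eq_adjoint] at this ⊢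
  rw [LinearMap.adjoint_inner_left]
  exact this

theorem LinearMap.IsPositive.mul_mul_star {A : V →ₗ[ℂ] V} (hA : A.IsPositive)
    (B : V →ₗ[ℂ] V) : (B * A * star B).IsPositive := by
  rw [LinearMap.star_eq_adjoint]
  exact hA.conj_adjoint B

theorem LinearMap.IsPositive.mul_star_eq_zero_of_sum_trace {α : Type*} [Fintype α]
    {A : V →ₗ[ℂ] V} (hA : A.IsPositive) (B : α → (V →ₗ[ℂ] V))
    (h : LinearMap.trace ℂ V (∑ a, B a * A * star (B a)) = 0) (a : α) : A * star (B a) = 0 := by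
  refine hA.mul_star_eq_zero _ ?_
  rw [map_sum] at h
  exact (hA.mul_mul_star (B a)).eq_zero_of_trace ((Finset.sum_eq_zero_iff_of_nonneg
    (fun i _ => (hA.mul_mul_star (B i)).trace_nonneg)).1 h a (Finset.mem_univ a))

end Positive

/-! ### Choi's theorem and the Kraus form of a channel. -/

section Kraus

variable {V : Type*} [NormedAddCommGroup V] [InnerProductSpace ℂ V] [FiniteDimensional ℂ V]

/-- The super-operator `X ↦ ∑ a, K a * X * (K a)*` with Kraus operators `K a`. -/
noncomputable def krausMap {α : Type*} [Fintype α] (K : α → (V →ₗ[ℂ] V)) : SuperOp V where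
  toFun X := ∑ a, K a * X * star (K a)
  map_add' X Y := by simp [mul_add, add_mul, Finset.sum_add_distrib]
  map_smul' c X := by simp [Finset.smul_sum]

theorem krausMap_apply {α : Type*} [Fintype α] (K : α → (V →ₗ[ℂ] V)) (X : V →ₗ[ℂ] V) :
    krausMap K X = ∑ a, K a * X * star (K a) := rfl

open InnerProductSpace in
theorem trace_mul_rankOne (S : V →ₗ[ℂ] V) (x y : V) :
    LinearMap.trace ℂ V (S * (rankOne ℂ x y).toLinearMap) = ⟪y, S x⟫_ℂ := by
  have : S * (rankOne ℂ x y).toLinearMap = (rankOne ℂ (S x) y).toLinearMap := by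
    ext v; simp
  rw [this, InnerProductSpace.trace_rankOne]

omit [FiniteDimensional ℂ V] in
open InnerProductSpace in
theorem span_rankOne_basis {ι : Type*} [Fintype ι] (b : OrthonormalBasis ι ℂ V) (X : V →ₗ[ℂ] V) :
    X = ∑ j, ∑ k, ⟪b j, X (b k)⟫_ℂ • (rankOne ℂ (b j) (b k)).toLinearMap := by
  classical
  refine b.toBasis.ext fun k => ?_
  simp only [OrthonormalBasis.coe_toBasis, LinearMap.sum_apply, LinearMap.smul_apply,
    ContinuousLinearMap.coe_coe, rankOne_apply, orthonormal_iff_ite.1 b.orthonormal, ite_smul,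
    one_smul, zero_smul, smul_ite, smul_zero, Finset.sum_ite_eq', Finset.mem_univ, if_true]
  exact (b.sum_repr' (X (b k))).symm

open InnerProductSpace in
-- Choi's argument: applying `Ψ ⊗ 1` to a maximally entangled projector gives a positive operator
-- that encodes `Ψ`, and each rank-one term of this operator, read as a matrix, is a Kraus operator.
theorem IsCompletelyPositive.exists_eq_krausMap {Ψ : SuperOp V} (hΨ : IsCompletelyPositive Ψ) :
    ∃ (m : ℕ) (K : Fin m → (V →ₗ[ℂ] V)), Ψ = krausMap K := by
  classical
  set n := Module.finrank ℂ V
  set b := stdOrthonormalBasis ℂ V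
  let e : OrthonormalBasis (Fin n) ℂ (EuclideanSpace ℂ (Fin n)) := EuclideanSpace.basisFun _ ℂ
  -- The unnormalised maximally entangled vector: `|Ω⟩⟨Ω|` is the sum of all `E_jk ⊗ E_jk`.
  let Ω : V ⊗[ℂ] EuclideanSpace ℂ (Fin n) := ∑ j, b j ⊗ₜ e j
  let P := (rankOne ℂ Ω Ω).toLinearMap
  have hP : P.IsPositive := (InnerProductSpace.isPositive_rankOne_self Ω).toLinearMap
  have hPsum : P = homTensorHomEquiv ℂ V (EuclideanSpace ℂ (Fin n)) V (EuclideanSpace ℂ (Fin n))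
      (∑ j, ∑ k, (rankOne ℂ (b j) (b k)).toLinearMap ⊗ₜ (rankOne ℂ (e j) (e k)).toLinearMap) := by
    refine TensorProduct.ext' fun v w => ?_
    rw [homTensorHomEquiv_apply]
    simp only [P, map_sum, LinearMap.sum_apply, TensorProduct.homTensorHomMap_apply,
      TensorProduct.map_tmul, ContinuousLinearMap.coe_coe, rankOne_apply,
      TensorProduct.smul_tmul_smul]
    rw [Finset.sum_comm]
    simp only [← Finset.smul_sum, ← Finset.sum_smul]
    simp only [Ω, sum_inner, TensorProduct.inner_tmul]
  have hC := (hΨ.isPositive_ampliation n).map_isPositive P hP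
  have hCsum : ampliation (EuclideanSpace ℂ (Fin n)) Ψ P =
      ∑ j, ∑ k, TensorProduct.map (Ψ (rankOne ℂ (b j) (b k)).toLinearMap)
        (rankOne ℂ (e j) (e k)).toLinearMap := by
    rw [hPsum]
    simp only [ampliation, LinearMap.comp_apply, LinearEquiv.coe_coe, LinearEquiv.symm_apply_apply]
    simp only [homTensorHomEquiv_apply, map_sum, TensorProduct.map_tmul,
      TensorProduct.homTensorHomMap_apply, LinearMap.id_apply]
  obtain ⟨c, hc⟩ := hC.exists_eq_sum_inner_smul
  -- The `(j, k)` block of the Choi operator is `Ψ (E_jk)`, expanded here through the rank-one terms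
  -- `c a`.
  have hentry : ∀ j k v w, ⟪v, Ψ (rankOne ℂ (b j) (b k)).toLinearMap w⟫_ℂ =
      ∑ a, ⟪c a, w ⊗ₜ e k⟫_ℂ * ⟪v ⊗ₜ e j, c a⟫_ℂ := by
    intro j k v w
    have h1 : ⟪v ⊗ₜ e j, ampliation (EuclideanSpace ℂ (Fin n)) Ψ P (w ⊗ₜ e k)⟫_ℂ =
        ⟪v, Ψ (rankOne ℂ (b j) (b k)).toLinearMap w⟫_ℂ := by
      rw [hCsum]
      simp only [LinearMap.sum_apply, inner_sum, TensorProduct.map_tmul, TensorProduct.inner_tmul,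
        ContinuousLinearMap.coe_coe, rankOne_apply, inner_smul_right,
        orthonormal_iff_ite.1 e.orthonormal]
      simp
    rw [← h1, hc, inner_sum]
    simp [inner_smul_right]
  -- `K a` is the vector `c a` of the tensor product reshaped into an operator: its column `j` is
  -- the `e j` component of `c a`.
  let K : Fin _ → (V →ₗ[ℂ] V) := fun a => b.toBasis.constr ℂ fun j =>
    ∑ l, ⟪b l ⊗ₜ e j, c a⟫_ℂ • b l
  have hK : ∀ a j v, ⟪v, K a (b j)⟫_ℂ = ⟪v ⊗ₜ e j, c a⟫_ℂ := by
    intro a j v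
    have : K a (b j) = ∑ l, ⟪b l ⊗ₜ e j, c a⟫_ℂ • b l := by
      have := b.toBasis.constr_basis ℂ (fun j => ∑ l, ⟪b l ⊗ₜ e j, c a⟫_ℂ • b l) j
      rwa [OrthonormalBasis.coe_toBasis] at this
    rw [this, inner_sum]
    conv_rhs => rw [← b.sum_repr' v, TensorProduct.sum_tmul, sum_inner]
    refine Finset.sum_congr rfl fun l _ => ?_
    have hs : ⟪⟪b l, v⟫_ℂ • b l ⊗ₜ[ℂ] e j, c a⟫_ℂ = ⟪v, b l⟫_ℂ * ⟪b l ⊗ₜ[ℂ] e j, c a⟫_ℂ :=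
      (inner_smul_left (𝕜 := ℂ) (b l ⊗ₜ[ℂ] e j) (c a) _).trans (by rw [inner_conj_symm])
    rw [← TensorProduct.smul_tmul', hs, inner_smul_right, mul_comm]
  refine ⟨_, K, LinearMap.ext fun X => ?_⟩
  rw [span_rankOne_basis b X]
  simp only [map_sum, map_smul]
  refine Finset.sum_congr rfl fun j _ => Finset.sum_congr rfl fun k _ => ?_
  congr 1
  refine LinearMap.ext fun w => ext_inner_left ℂ fun v => ?_
  rw [hentry, krausMap_apply, LinearMap.sum_apply, inner_sum]
  refine Finset.sum_congr rfl fun a _ => ?_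
  simp only [Module.End.mul_apply, ContinuousLinearMap.coe_coe, rankOne_apply, map_smul,
    inner_smul_right, LinearMap.star_eq_adjoint, LinearMap.adjoint_inner_right, hK]
  rw [← inner_conj_symm (K a (b k)), hK]
  exact congrArg (· * _) (inner_conj_symm (𝕜 := ℂ) (c a) (w ⊗ₜ[ℂ] e k)).symm

/-- Trace preservation on rank-one operators determines all matrix entries of the sum, by cyclicity
of the trace. -/
theorem sum_star_mul_eq_one_of_isTracePreserving {α : Type*} [Fintype α] {K : α → (V →ₗ[ℂ] V)}
    (h : IsTracePreserving (krausMap K)) : ∑ a, star (K a) * K a = 1 := by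
  refine LinearMap.ext fun x => ext_inner_left ℂ fun y => ?_
  have h1 := h (InnerProductSpace.rankOne ℂ x y).toLinearMap
  rw [krausMap_apply, map_sum] at h1
  rw [← trace_mul_rankOne, ← trace_mul_rankOne, one_mul, ← h1, Finset.sum_mul, map_sum]
  refine Finset.sum_congr rfl fun a _ => ?_
  rw [LinearMap.trace_mul_comm, mul_assoc, LinearMap.trace_mul_comm, mul_assoc,
    LinearMap.trace_mul_comm, mul_assoc]

theorem trace_krausMap {α : Type*} [Fintype α] {K : α → (V →ₗ[ℂ] V)}
    (h : ∑ a, star (K a) * K a = 1) (X : V →ₗ[ℂ] V) :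
    LinearMap.trace ℂ V (krausMap K X) = LinearMap.trace ℂ V X := by
  conv_rhs => rw [← one_mul X, ← h, Finset.sum_mul, map_sum]
  rw [krausMap_apply, map_sum]
  refine Finset.sum_congr rfl fun a _ => ?_
  rw [LinearMap.trace_mul_comm, mul_assoc]

end Kraus

/-! ### Fixed points of a channel: positive parts, maximal support, commutation. -/

section FixedPoints

variable {V : Type*} [NormedAddCommGroup V] [InnerProductSpace ℂ V] [FiniteDimensional ℂ V]

open InnerProductSpace in
-- Jordan decomposition, obtained by applying real functions to the eigenvalues. The projection `P`
-- onto the strictly positive eigenspaces is kept because it separates `p` from `q`.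
theorem LinearMap.IsSymmetric.exists_eq_sub_isPositive {μ : V →ₗ[ℂ] V} (hμ : μ.IsSymmetric) :
    ∃ p q P : V →ₗ[ℂ] V, p.IsPositive ∧ q.IsPositive ∧ μ = p - q ∧ star P = P ∧ P * P = P ∧
      P * p = p ∧ P * q = 0 := by
  set u := hμ.eigenvectorBasis rfl
  set l := hμ.eigenvalues rfl
  let D : (Fin (Module.finrank ℂ V) → ℝ) → (V →ₗ[ℂ] V) := fun f =>
    ∑ a, (f a : ℂ) • (rankOne ℂ (u a) (u a)).toLinearMap
  have hDu : ∀ f a, D f (u a) = (f a : ℂ) • u a := by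
    intro f a
    simp only [D, LinearMap.sum_apply, LinearMap.smul_apply, ContinuousLinearMap.coe_coe,
      rankOne_apply, orthonormal_iff_ite.1 u.orthonormal]
    simp
  have hext : ∀ S T : V →ₗ[ℂ] V, (∀ a, S (u a) = T (u a)) → S = T := fun S T h =>
    u.toBasis.ext fun a => by simpa using h a
  have hpos : ∀ f, (∀ a, 0 ≤ f a) → (D f).IsPositive := fun f hf =>
    LinearMap.isPositive_sum _ fun a _ =>
      (InnerProductSpace.isPositive_rankOne_self (u a)).toLinearMap.smul_of_nonneg
        (Complex.zero_le_real.2 (hf a))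
  have hmul : ∀ f g, D f * D g = D (f * g) := fun f g => hext _ _ fun a => by
    rw [Module.End.mul_apply, hDu, map_smul, hDu, hDu, smul_smul, Pi.mul_apply,
      Complex.ofReal_mul, mul_comm]
  have hP : ∀ a, (0 : ℝ) ≤ if 0 < l a then 1 else 0 := fun a => by split_ifs <;> norm_num
  refine ⟨D fun a => max (l a) 0, D fun a => max (-l a) 0, D fun a => if 0 < l a then 1 else 0,
    hpos _ fun a => le_max_right _ _, hpos _ fun a => le_max_right _ _, ?_, ?_, ?_, ?_, ?_⟩
  · refine hext _ _ fun a => ?_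
    rw [hμ.apply_eigenvectorBasis, LinearMap.sub_apply, hDu, hDu, ← sub_smul, ← Complex.ofReal_sub]
    change ((l a : ℝ) : ℂ) • u a = _
    congr 2
    rcases le_total 0 (l a) with h | h
    · rw [max_eq_left h, max_eq_right (by linarith), sub_zero]
    · rw [max_eq_right h, max_eq_left (by linarith)]; ring
  · rw [LinearMap.star_eq_adjoint]
    exact (hpos _ hP).adjoint_eq
  · rw [hmul]; congr 1; ext a; simp only [Pi.mul_apply]; split_ifs <;> norm_num
  · rw [hmul]; congr 1; ext a; simp only [Pi.mul_apply]
    split_ifs with h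
    · rw [one_mul]
    · rw [zero_mul, max_eq_right (not_lt.1 h)]
  · rw [hmul]
    have : D 0 = 0 := by simp [D]
    rw [← this]; congr 1; ext a; simp only [Pi.mul_apply, Pi.zero_apply]
    split_ifs with h
    · rw [one_mul, max_eq_right (by linarith)]
    · rw [zero_mul]

theorem star_krausMap {α : Type*} [Fintype α] (K : α → (V →ₗ[ℂ] V)) (X : V →ₗ[ℂ] V) :
    star (krausMap K X) = krausMap K (star X) := by
  simp [krausMap_apply, star_sum, mul_assoc]

theorem LinearMap.IsPositive.krausMap {α : Type*} [Fintype α] (K : α → (V →ₗ[ℂ] V))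
    {X : V →ₗ[ℂ] V} (hX : X.IsPositive) : (krausMap K X).IsPositive :=
  LinearMap.isPositive_sum _ fun a _ => hX.mul_mul_star (K a)

theorem LinearMap.IsPositive.star_eq {X : V →ₗ[ℂ] V} (hX : X.IsPositive) : star X = X := by
  rw [LinearMap.star_eq_adjoint, hX.adjoint_eq]

/-- The positive part of a Hermitian fixed point of a channel is a fixed point. -/
theorem krausMap_fixed_of_eq_sub {α : Type*} [Fintype α] {K : α → (V →ₗ[ℂ] V)}
    (hK : ∑ a, star (K a) * K a = 1) {p q P : V →ₗ[ℂ] V} (hp : p.IsPositive) (hq : q.IsPositive)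
    (hP : star P = P) (hPP : P * P = P) (hPp : P * p = p) (hPq : P * q = 0)
    (hfix : krausMap K (p - q) = p - q) : krausMap K p = p := by
  have hA := hp.krausMap K
  have hB := hq.krausMap K
  have htr := trace_krausMap hK p
  rw [map_sub] at hfix
  set A := krausMap K p
  set B := krausMap K q
  have hQQ : (1 - P) * (1 - P) = 1 - P := by rw [mul_sub, sub_mul, sub_mul, hPP]; simp
  have hQ : star (1 - P) = 1 - P := by rw [star_sub, star_one, hP]
  -- With `A`, `B` the images of `p`, `q`, trace preservation and `A - B = p - q` give `tr (1 - P) A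
  -- + tr P B = 0`. Both terms are nonnegative, so `A` lives on the range of `P` and `B` on its
  -- complement; multiplying `A - B = p - q` by `P` then gives `A = p`.
  have h1 : LinearMap.trace ℂ V ((1 - P) * A * star (1 - P)) =
      LinearMap.trace ℂ V p - LinearMap.trace ℂ V (P * A) := by
    rw [hQ, LinearMap.trace_mul_comm, ← mul_assoc, hQQ, sub_mul, one_mul, map_sub, htr]
  have h2 : LinearMap.trace ℂ V (P * B * star P) = LinearMap.trace ℂ V (P * B) := by
    rw [hP, LinearMap.trace_mul_comm, ← mul_assoc, hPP]
  have h3 : LinearMap.trace ℂ V (P * A) - LinearMap.trace ℂ V (P * B) = LinearMap.trace ℂ V p := by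
    rw [← map_sub, ← mul_sub, hfix, mul_sub, hPp, hPq, sub_zero]
  have n1 := (hA.mul_mul_star (1 - P)).trace_nonneg
  have n2 := (hB.mul_mul_star P).trace_nonneg
  have h4 : LinearMap.trace ℂ V ((1 - P) * A * star (1 - P)) +
      LinearMap.trace ℂ V (P * B * star P) = 0 := by
    rw [h1, h2, ← h3]; ring
  have e1 := hA.mul_star_eq_zero _ ((hA.mul_mul_star (1 - P)).eq_zero_of_trace
    ((add_eq_zero_iff_of_nonneg n1 n2).1 h4).1)
  have e2 := hB.mul_star_eq_zero _ ((hB.mul_mul_star P).eq_zero_of_trace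
    ((add_eq_zero_iff_of_nonneg n1 n2).1 h4).2)
  rw [hQ, mul_sub, mul_one, sub_eq_zero] at e1
  rw [hP] at e2
  have hpP : p * P = p := by
    have := congrArg star hPp
    rwa [star_mul, hP, hp.star_eq] at this
  have hqP : q * P = 0 := by
    have := congrArg star hPq
    rwa [star_mul, hP, hq.star_eq, star_zero] at this
  have h5 := congrArg (· * P) hfix
  simp only [sub_mul, e2, hpP, hqP, sub_zero] at h5
  rw [e1, h5]

/-- `⟪x, (A + B) x⟫` is a sum of two nonnegative terms. Hence adding positive fixed points joins
their supports. -/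
theorem LinearMap.IsPositive.ker_add {A B : V →ₗ[ℂ] V} (hA : A.IsPositive) (hB : B.IsPositive) :
    (A + B).ker = A.ker ⊓ B.ker := by
  ext x
  simp only [Submodule.mem_inf, LinearMap.mem_ker]
  refine ⟨fun h => ?_, fun h => by rw [LinearMap.add_apply, h.1, h.2, add_zero]⟩
  have h1 : ⟪x, A x⟫_ℂ + ⟪x, B x⟫_ℂ = 0 := by
    rw [← inner_add_right, ← LinearMap.add_apply, h, inner_zero_right]
  have h2 := (add_eq_zero_iff_of_nonneg (hA.inner_nonneg_right x) (hB.inner_nonneg_right x)).1 h1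
  exact ⟨hA.apply_eq_zero_of_inner h2.1, hB.apply_eq_zero_of_inner h2.2⟩

/-- A channel has a positive fixed point whose support contains the supports of all fixed points. -/
theorem exists_isPositive_fixed_ker_le {α : Type*} [Fintype α] {K : α → (V →ₗ[ℂ] V)}
    (hK : ∑ a, star (K a) * K a = 1) :
    ∃ σ : V →ₗ[ℂ] V, σ.IsPositive ∧ krausMap K σ = σ ∧
      ∀ μ, krausMap K μ = μ → σ.ker ≤ μ.ker := by
  classical
  -- `σ` is chosen with kernel of least dimension. For a positive fixed point `p`, `σ + p` cannot
  -- have a smaller kernel, so `ker σ ≤ ker p`.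
  have hex : ∃ k, ∃ σ : V →ₗ[ℂ] V, σ.IsPositive ∧ krausMap K σ = σ ∧
      Module.finrank ℂ σ.ker = k := ⟨_, 0, LinearMap.isPositive_zero, map_zero _, rfl⟩
  obtain ⟨σ, hσ, hfix, hk⟩ := Nat.find_spec hex
  have hpos : ∀ p : V →ₗ[ℂ] V, p.IsPositive → krausMap K p = p → σ.ker ≤ p.ker := by
    intro p hp hpf
    have hker := hσ.ker_add hp
    have hmin : Nat.find hex ≤ Module.finrank ℂ (σ + p).ker :=
      Nat.find_min' hex ⟨σ + p, hσ.add hp, by rw [map_add, hfix, hpf], rfl⟩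
    have hle : (σ + p).ker ≤ σ.ker := by rw [hker]; exact inf_le_left
    have heq := Submodule.eq_of_le_of_finrank_le hle (by rw [hk]; exact hmin)
    rw [← heq, hker]; exact inf_le_right
  have hsymm : ∀ μ : V →ₗ[ℂ] V, star μ = μ → krausMap K μ = μ → σ.ker ≤ μ.ker := by
    intro μ hμ hf
    have hμs : μ.IsSymmetric := (LinearMap.isSymmetric_iff_isSelfAdjoint μ).2 hμ
    obtain ⟨p, q, P, hp, hq, rfl, hP, hPP, hPp, hPq⟩ := hμs.exists_eq_sub_isPositive
    have h1 := krausMap_fixed_of_eq_sub hK hp hq hP hPP hPp hPq hf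
    have h2 : krausMap K q = q := by
      rw [map_sub, h1] at hf
      exact sub_right_injective hf
    intro x hx
    rw [LinearMap.mem_ker, LinearMap.sub_apply, hpos p hp h1 hx, hpos q hq h2 hx, sub_zero]
  refine ⟨σ, hσ, hfix, fun μ hμ x hx => ?_⟩
  have hμ' : krausMap K (star μ) = star μ := by rw [← star_krausMap, hμ]
  -- A general fixed point is handled through the Hermitian fixed points `μ + μ*` and `i (μ - μ*)`.
  have h1 := hsymm (μ + star μ) (by rw [star_add, star_star, add_comm])
    (by rw [map_add, hμ, hμ']) hx
  have h2 := hsymm (Complex.I • (μ - star μ))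
    (by rw [star_smul, star_sub, star_star]; simp [← smul_neg])
    (by rw [map_smul, map_sub, hμ, hμ']) hx
  rw [LinearMap.mem_ker] at h1 h2 ⊢
  rw [LinearMap.smul_apply, smul_eq_zero_iff_right Complex.I_ne_zero, LinearMap.sub_apply,
    sub_eq_zero] at h2
  rw [LinearMap.add_apply, ← h2, ← two_smul ℂ, smul_eq_zero_iff_right two_ne_zero] at h1
  exact h1

theorem trace_krausMap_mul {α : Type*} [Fintype α] (L : α → (V →ₗ[ℂ] V)) (X Y : V →ₗ[ℂ] V) :
    LinearMap.trace ℂ V (krausMap L X * Y) =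
      LinearMap.trace ℂ V (X * ∑ a, star (L a) * Y * L a) := by
  rw [krausMap_apply, Finset.sum_mul, Finset.mul_sum, map_sum, map_sum]
  refine Finset.sum_congr rfl fun a _ => ?_
  rw [mul_assoc, mul_assoc, LinearMap.trace_mul_comm]
  simp only [mul_assoc]

/-- The left side is the trace of a positive operator that detects commutation; the right side
involves the channel only at `σ y*` and `y σ`, where fixed-point identities or duality evaluate it.
-/
theorem trace_sum_commutator {α : Type*} [Fintype α] {L : α → (V →ₗ[ℂ] V)}
    (hL : ∑ a, star (L a) * L a = 1) {σ : V →ₗ[ℂ] V} (hfix : krausMap L σ = σ) (y : V →ₗ[ℂ] V) :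
    LinearMap.trace ℂ V (∑ a, (y * L a - L a * y) * σ * star (y * L a - L a * y)) =
      LinearMap.trace ℂ V (y * σ * star y) - LinearMap.trace ℂ V (krausMap L (σ * star y) * y) -
      LinearMap.trace ℂ V (krausMap L (y * σ) * star y) +
      LinearMap.trace ℂ V (y * σ * star y) := by
  have h : ∑ a, (y * L a - L a * y) * σ * star (y * L a - L a * y) =
      y * krausMap L σ * star y - y * krausMap L (σ * star y) - krausMap L (y * σ) * star y +
      krausMap L (y * σ * star y) := by
    simp only [krausMap_apply, Finset.mul_sum, Finset.sum_mul, ← Finset.sum_sub_distrib,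
      ← Finset.sum_add_distrib, star_sub, star_mul]
    refine Finset.sum_congr rfl fun a _ => ?_
    noncomm_ring
  rw [h, hfix, map_add, map_sub, map_sub, trace_krausMap hL,
    LinearMap.trace_mul_comm ℂ y (krausMap L (σ * star y))]

/-- Each summand `C σ C*` is positive, so zero total trace forces `σ C* = 0`, and `σ` cancels on the
left. -/
theorem commute_of_trace_commutator_eq_zero {α : Type*} [Fintype α] {L : α → (V →ₗ[ℂ] V)}
    {σ s : V →ₗ[ℂ] V} (hσ : σ.IsPositive) (hs : s * σ = 1) {y : V →ₗ[ℂ] V}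
    (h : LinearMap.trace ℂ V (∑ a, (y * L a - L a * y) * σ * star (y * L a - L a * y)) = 0) (a : α) :
    y * L a = L a * y := by
  have h1 := hσ.mul_star_eq_zero_of_sum_trace (fun a => y * L a - L a * y) h a
  have h2 := congrArg (s * ·) h1
  simp only [← mul_assoc, hs, one_mul, mul_zero] at h2
  exact sub_eq_zero.1 (star_eq_zero.1 h2)

/-- Given an invertible positive fixed point `σ` of a channel, every fixed point is of the form
`x * σ` with `x` commuting with the Kraus operators and their adjoints. -/
theorem exists_commute_of_fixed {α : Type*} [Fintype α] {L : α → (V →ₗ[ℂ] V)}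
    (hL : ∑ a, star (L a) * L a = 1) {σ s : V →ₗ[ℂ] V} (hσ : σ.IsPositive)
    (hfix : krausMap L σ = σ) (hs : s * σ = 1) {μ : V →ₗ[ℂ] V} (hμ : krausMap L μ = μ) :
    ∃ x, μ = x * σ ∧ (∀ a, x * L a = L a * x) ∧ ∀ a, x * star (L a) = star (L a) * x := by
  obtain ⟨x, hμx⟩ : ∃ x, μ = x * σ := ⟨μ * s, by rw [mul_assoc, hs, mul_one]⟩
  -- Both `x σ = μ` and its adjoint `σ x*` are fixed, so the four trace terms cancel.
  have h1 : ∀ a, x * L a = L a * x := by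
    refine commute_of_trace_commutator_eq_zero hσ hs ?_
    have h2 : krausMap L (σ * star x) = σ * star x := by
      have := star_krausMap L (x * σ)
      rw [← hμx, hμ, hμx, star_mul, hσ.star_eq] at this
      exact this.symm
    rw [trace_sum_commutator hL hfix, h2, ← hμx, hμ, hμx,
      LinearMap.trace_mul_comm ℂ (σ * star x), ← mul_assoc]
    ring
  -- For `y = x*` it is not known that `x* σ` is fixed. Instead, commutation with `L a` makes `x`,
  -- hence `x*`, fixed by the dual map, and the trace terms are evaluated by duality.
  have h2 : ∑ a, star (L a) * x * L a = x := by
    simp only [mul_assoc, h1]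
    conv_rhs => rw [← one_mul x, ← hL, Finset.sum_mul]
    exact Finset.sum_congr rfl fun a _ => by rw [mul_assoc]
  have h3 : ∑ a, star (L a) * star x * L a = star x := by
    conv_rhs => rw [← h2]
    simp [star_sum, mul_assoc]
  have h4 : ∀ a, star x * L a = L a * star x := by
    refine commute_of_trace_commutator_eq_zero hσ hs ?_
    rw [trace_sum_commutator hL hfix, trace_krausMap_mul, trace_krausMap_mul, star_star, h2, h3,
      LinearMap.trace_mul_comm ℂ (σ * x), ← mul_assoc]
    ring
  refine ⟨x, hμx, h1, fun a => ?_⟩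
  have := congrArg star (h4 a)
  rw [star_mul, star_mul, star_star] at this
  exact this.symm

end FixedPoints

/-! ### Intertwiners, Schur's lemma and irreducible subspaces. -/

section Intertwines

variable {α : Type*}
variable {U V Z : Type*} [NormedAddCommGroup V] [InnerProductSpace ℂ V] [FiniteDimensional ℂ V]
  [NormedAddCommGroup Z] [InnerProductSpace ℂ Z] [FiniteDimensional ℂ Z]
  [NormedAddCommGroup U] [InnerProductSpace ℂ U] [FiniteDimensional ℂ U]

/-- `f` intertwines the operators `M a` on `Z` with the operators `L a` on `V`, and likewise for
their adjoints. -/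
def Intertwines (L : α → (V →ₗ[ℂ] V)) (M : α → (Z →ₗ[ℂ] Z)) (f : Z →ₗ[ℂ] V) : Prop :=
  ∀ a, L a ∘ₗ f = f ∘ₗ M a ∧
    LinearMap.adjoint (L a) ∘ₗ f = f ∘ₗ LinearMap.adjoint (M a)

variable {L : α → (V →ₗ[ℂ] V)} {M : α → (Z →ₗ[ℂ] Z)} {N : α → (U →ₗ[ℂ] U)}

theorem Intertwines.comp {f : Z →ₗ[ℂ] V} {g : U →ₗ[ℂ] Z} (hf : Intertwines L M f)
    (hg : Intertwines M N g) : Intertwines L N (f ∘ₗ g) := fun a => by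
  constructor
  · rw [← LinearMap.comp_assoc, (hf a).1, LinearMap.comp_assoc, (hg a).1, LinearMap.comp_assoc]
  · rw [← LinearMap.comp_assoc, (hf a).2, LinearMap.comp_assoc, (hg a).2, LinearMap.comp_assoc]

theorem Intertwines.adjoint {f : Z →ₗ[ℂ] V} (hf : Intertwines L M f) :
    Intertwines M L (LinearMap.adjoint f) := fun a => by
  constructor
  · have := congrArg LinearMap.adjoint (hf a).2
    rw [LinearMap.adjoint_comp, LinearMap.adjoint_comp, LinearMap.adjoint_adjoint,
      LinearMap.adjoint_adjoint] at this
    exact this.symm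
  · have := congrArg LinearMap.adjoint (hf a).1
    rw [LinearMap.adjoint_comp, LinearMap.adjoint_comp] at this
    exact this.symm

theorem LinearIsometry.adjoint_apply_apply (g : Z →ₗᵢ[ℂ] V) (x : Z) :
    LinearMap.adjoint g.toLinearMap (g x) = x :=
  LinearMap.congr_fun g.adjoint_comp_self' x

theorem LinearIsometry.apply_adjoint_of_mem_range (g : Z →ₗᵢ[ℂ] V) {v : V}
    (hv : v ∈ LinearMap.range g.toLinearMap) : g (LinearMap.adjoint g.toLinearMap v) = v := by
  obtain ⟨x, rfl⟩ := hv
  exact congrArg g (g.adjoint_apply_apply x)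

theorem LinearIsometry.comp_comp_adjoint_comp (g : Z →ₗᵢ[ℂ] V) (f : U →ₗᵢ[ℂ] Z) :
    (g.comp f).toLinearMap ∘ₗ LinearMap.adjoint (g.comp f).toLinearMap =
      g.toLinearMap ∘ₗ (f.toLinearMap ∘ₗ LinearMap.adjoint f.toLinearMap) ∘ₗ
        LinearMap.adjoint g.toLinearMap := by
  change (g.toLinearMap ∘ₗ f.toLinearMap) ∘ₗ
    LinearMap.adjoint (g.toLinearMap ∘ₗ f.toLinearMap) = _
  rw [LinearMap.adjoint_comp]
  simp only [LinearMap.comp_assoc]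

theorem LinearIsometry.adjoint_comp_comp_comp {U' : Type*} [NormedAddCommGroup U']
    [InnerProductSpace ℂ U'] [FiniteDimensional ℂ U'] (g : Z →ₗᵢ[ℂ] V) (f : U →ₗᵢ[ℂ] Z)
    (f' : U' →ₗᵢ[ℂ] Z) :
    LinearMap.adjoint (g.comp f).toLinearMap ∘ₗ (g.comp f').toLinearMap =
      LinearMap.adjoint f.toLinearMap ∘ₗ f'.toLinearMap := by
  change LinearMap.adjoint (g.toLinearMap ∘ₗ f.toLinearMap) ∘ₗ
    (g.toLinearMap ∘ₗ f'.toLinearMap) = _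
  rw [LinearMap.adjoint_comp, LinearMap.comp_assoc, ← LinearMap.comp_assoc _ g.toLinearMap,
    g.adjoint_comp_self', LinearMap.id_comp]

/-- The compression of an operator on `V` along an isometry into `V`. -/
noncomputable def compression (g : Z →ₗᵢ[ℂ] V) (T : V →ₗ[ℂ] V) : Z →ₗ[ℂ] Z :=
  LinearMap.adjoint g.toLinearMap ∘ₗ T ∘ₗ g.toLinearMap

theorem adjoint_compression (g : Z →ₗᵢ[ℂ] V) (T : V →ₗ[ℂ] V) :
    LinearMap.adjoint (compression g T) = compression g (LinearMap.adjoint T) := by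
  simp only [compression, LinearMap.adjoint_comp, LinearMap.adjoint_adjoint, LinearMap.comp_assoc]

theorem comp_compression (g : Z →ₗᵢ[ℂ] V) {T : V →ₗ[ℂ] V}
    (hT : ∀ x, T (g x) ∈ LinearMap.range g.toLinearMap) :
    T ∘ₗ g.toLinearMap = g.toLinearMap ∘ₗ compression g T :=
  LinearMap.ext fun x => (g.apply_adjoint_of_mem_range (hT x)).symm

theorem intertwines_compression (g : Z →ₗᵢ[ℂ] V)
    (h : ∀ a x, L a (g x) ∈ LinearMap.range g.toLinearMap)
    (h' : ∀ a x, LinearMap.adjoint (L a) (g x) ∈ LinearMap.range g.toLinearMap) :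
    Intertwines L (fun a => compression g (L a)) g.toLinearMap := fun a =>
  ⟨comp_compression g (h a), by rw [adjoint_compression]; exact comp_compression g (h' a)⟩

/-- The operators `M a` and their adjoints have no nontrivial common invariant subspace. -/
def IsIrreducibleFamily (M : α → (Z →ₗ[ℂ] Z)) : Prop :=
  ∀ S : Submodule ℂ Z, (∀ a, ∀ x ∈ S, M a x ∈ S) → (∀ a, ∀ x ∈ S, LinearMap.adjoint (M a) x ∈ S) →
    S = ⊥ ∨ S = ⊤

/-- **Schur's lemma** for families of operators closed under adjoints. -/
theorem IsIrreducibleFamily.eq_smul_id [Nontrivial Z] (hM : IsIrreducibleFamily M)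
    {T : Z →ₗ[ℂ] Z} (hT : Intertwines M M T) : ∃ c : ℂ, T = c • LinearMap.id := by
  obtain ⟨c, hc⟩ := Module.End.exists_eigenvalue (K := ℂ) T
  refine ⟨c, ?_⟩
  have := hM (Module.End.eigenspace T c)
    (fun a x hx => by
      rw [Module.End.mem_eigenspace_iff] at hx ⊢
      have := LinearMap.congr_fun (hT a).1 x
      simp only [LinearMap.comp_apply] at this
      rw [← this, hx, map_smul])
    (fun a x hx => by
      rw [Module.End.mem_eigenspace_iff] at hx ⊢
      have := LinearMap.congr_fun (hT a).2 x
      simp only [LinearMap.comp_apply] at this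
      rw [← this, hx, map_smul])
  rcases this with h | h
  · exact absurd h hc
  · refine LinearMap.ext fun x => ?_
    have hx : x ∈ Module.End.eigenspace T c := by rw [h]; exact Submodule.mem_top
    simpa using Module.End.mem_eigenspace_iff.1 hx

theorem exists_isometry_range_eq (S : Submodule ℂ V) :
    ∃ g : EuclideanSpace ℂ (Fin (Module.finrank ℂ S)) →ₗᵢ[ℂ] V,
      LinearMap.range g.toLinearMap = S := by
  refine ⟨S.subtypeₗᵢ.comp (stdOrthonormalBasis ℂ S).repr.symm.toLinearIsometry, ?_⟩
  ext v
  constructor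
  · rintro ⟨x, rfl⟩
    exact ((stdOrthonormalBasis ℂ S).repr.symm x).2
  · intro hv
    exact ⟨(stdOrthonormalBasis ℂ S).repr ⟨v, hv⟩, by simp⟩

/-- A nonzero reducing subspace of least dimension is irreducible: a nonzero subspace of it
invariant under the family and its adjoints would again be a candidate. -/
theorem exists_irreducible [Nontrivial V] (L : α → (V →ₗ[ℂ] V)) :
    ∃ z : ℕ, 0 < z ∧ ∃ (f : EuclideanSpace ℂ (Fin z) →ₗᵢ[ℂ] V)
      (M : α → (EuclideanSpace ℂ (Fin z) →ₗ[ℂ] EuclideanSpace ℂ (Fin z))),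
      Intertwines L M f.toLinearMap ∧ IsIrreducibleFamily M := by
  classical
  have hex : ∃ z : ℕ, 0 < z ∧ ∃ (f : EuclideanSpace ℂ (Fin z) →ₗᵢ[ℂ] V)
      (M : α → (EuclideanSpace ℂ (Fin z) →ₗ[ℂ] EuclideanSpace ℂ (Fin z))),
      Intertwines L M f.toLinearMap := by
    obtain ⟨g, hg⟩ := exists_isometry_range_eq (⊤ : Submodule ℂ V)
    refine ⟨_, ?_, g, _, intertwines_compression g (fun a x => ?_) fun a x => ?_⟩
    · rw [finrank_top]; exact Module.finrank_pos
    · rw [hg]; trivial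
    · rw [hg]; trivial
  obtain ⟨z, ⟨hz, f, M, hf⟩, hmin⟩ : ∃ z : ℕ, (0 < z ∧ ∃ (f : EuclideanSpace ℂ (Fin z) →ₗᵢ[ℂ] V)
      (M : α → (EuclideanSpace ℂ (Fin z) →ₗ[ℂ] EuclideanSpace ℂ (Fin z))),
      Intertwines L M f.toLinearMap) ∧ ∀ k : ℕ, (0 < k ∧
      ∃ (f : EuclideanSpace ℂ (Fin k) →ₗᵢ[ℂ] V)
      (M : α → (EuclideanSpace ℂ (Fin k) →ₗ[ℂ] EuclideanSpace ℂ (Fin k))),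
      Intertwines L M f.toLinearMap) → z ≤ k :=
    ⟨Nat.find hex, Nat.find_spec hex, fun k => Nat.find_min' hex⟩
  refine ⟨z, hz, f, M, hf, fun S hS hS' => ?_⟩
  refine or_iff_not_imp_left.2 fun hbot => ?_
  obtain ⟨g, hg⟩ := exists_isometry_range_eq S
  have hmem : ∀ x, g x ∈ S := fun x => hg.le ⟨x, rfl⟩
  have hpos : 0 < Module.finrank ℂ S := by
    rw [Module.finrank_pos_iff]; exact (Submodule.nontrivial_iff_ne_bot).2 hbot
  have hle := hmin _ ⟨hpos, f.comp g, _,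
    hf.comp (intertwines_compression g (fun a x => by rw [hg]; exact hS a _ (hmem x))
      fun a x => by rw [hg]; exact hS' a _ (hmem x))⟩
  refine Submodule.eq_top_of_finrank_eq (le_antisymm (Submodule.finrank_le S) ?_)
  rw [finrank_euclideanSpace_fin]
  exact hle

end Intertwines

/-! ### Isotypic blocks and the orthogonal decomposition into them. -/

section Block

variable {α : Type*}
variable {V : Type*} [NormedAddCommGroup V] [InnerProductSpace ℂ V] [FiniteDimensional ℂ V]

/-- A copy of `ℂ^y ⊗ ℂ^z` inside `V` on which the operators `L a` act as `1 ⊗ M a`, and their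
adjoints as `1 ⊗ (M a)*`. -/
structure ReducingBlock (L : α → (V →ₗ[ℂ] V)) where
  y : ℕ
  z : ℕ
  y_pos : 0 < y
  z_pos : 0 < z
  W : (EuclideanSpace ℂ (Fin y) ⊗[ℂ] EuclideanSpace ℂ (Fin z)) →ₗᵢ[ℂ] V
  M : α → (EuclideanSpace ℂ (Fin z) →ₗ[ℂ] EuclideanSpace ℂ (Fin z))
  intertwines : Intertwines L (fun a => TensorProduct.map LinearMap.id (M a)) W.toLinearMap

/-- The embedding of a block in a reducing subspace of `V` as a block of `V`. -/
noncomputable abbrev ReducingBlock.lift {N : Type*} [NormedAddCommGroup N] [InnerProductSpace ℂ N]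
    [FiniteDimensional ℂ N] {L : α → (V →ₗ[ℂ] V)} {L' : α → (N →ₗ[ℂ] N)} (B : ReducingBlock L')
    (ι : N →ₗᵢ[ℂ] V) (hι : Intertwines L L' ι.toLinearMap) : ReducingBlock L where
  y := B.y
  z := B.z
  y_pos := B.y_pos
  z_pos := B.z_pos
  W := ι.comp B.W
  M := B.M
  intertwines := hι.comp B.intertwines

theorem ReducingBlock.lift_comp_adjoint {N : Type*} [NormedAddCommGroup N]
    [InnerProductSpace ℂ N] [FiniteDimensional ℂ N] {L : α → (V →ₗ[ℂ] V)} {L' : α → (N →ₗ[ℂ] N)}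
    (B : ReducingBlock L') (ι : N →ₗᵢ[ℂ] V) (hι : Intertwines L L' ι.toLinearMap) :
    (B.lift ι hι).W.toLinearMap ∘ₗ LinearMap.adjoint (B.lift ι hι).W.toLinearMap =
      ι.toLinearMap ∘ₗ (B.W.toLinearMap ∘ₗ LinearMap.adjoint B.W.toLinearMap) ∘ₗ
        LinearMap.adjoint ι.toLinearMap := by
  exact ι.comp_comp_adjoint_comp B.W

theorem ReducingBlock.comp_lift {N : Type*} [NormedAddCommGroup N]
    [InnerProductSpace ℂ N] [FiniteDimensional ℂ N] {L : α → (V →ₗ[ℂ] V)} {L' : α → (N →ₗ[ℂ] N)}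
    (B : ReducingBlock L') (ι : N →ₗᵢ[ℂ] V) (hι : Intertwines L L' ι.toLinearMap)
    {T : V →ₗ[ℂ] V} {T' : N →ₗ[ℂ] N}
    {X : (EuclideanSpace ℂ (Fin B.y) ⊗[ℂ] EuclideanSpace ℂ (Fin B.z)) →ₗ[ℂ]
      (EuclideanSpace ℂ (Fin B.y) ⊗[ℂ] EuclideanSpace ℂ (Fin B.z))}
    (hT : T ∘ₗ ι.toLinearMap = ι.toLinearMap ∘ₗ T')
    (hX : T' ∘ₗ B.W.toLinearMap = B.W.toLinearMap ∘ₗ X) :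
    T ∘ₗ (B.lift ι hι).W.toLinearMap = (B.lift ι hι).W.toLinearMap ∘ₗ X := by
  change T ∘ₗ (ι.toLinearMap ∘ₗ B.W.toLinearMap) = (ι.toLinearMap ∘ₗ B.W.toLinearMap) ∘ₗ X
  rw [← LinearMap.comp_assoc, hT, LinearMap.comp_assoc, hX, LinearMap.comp_assoc]

theorem ReducingBlock.adjoint_lift_comp_lift {N : Type*} [NormedAddCommGroup N]
    [InnerProductSpace ℂ N] [FiniteDimensional ℂ N] {L : α → (V →ₗ[ℂ] V)} {L' : α → (N →ₗ[ℂ] N)}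
    (B B' : ReducingBlock L') (ι : N →ₗᵢ[ℂ] V) (hι : Intertwines L L' ι.toLinearMap) :
    LinearMap.adjoint (B.lift ι hι).W.toLinearMap ∘ₗ (B'.lift ι hι).W.toLinearMap =
      LinearMap.adjoint B.W.toLinearMap ∘ₗ B'.W.toLinearMap := by
  exact ι.adjoint_comp_comp_comp B.W B'.W

theorem LinearMap.norm_apply_of_adjoint_comp_self {E : Type*} [NormedAddCommGroup E]
    [InnerProductSpace ℂ E] [FiniteDimensional ℂ E] {f : E →ₗ[ℂ] V}
    (h : LinearMap.adjoint f ∘ₗ f = LinearMap.id) (x : E) : ‖f x‖ = ‖x‖ := by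
  have : ⟪f x, f x⟫_ℂ = ⟪x, x⟫_ℂ := by
    rw [← LinearMap.adjoint_inner_right, ← LinearMap.comp_apply, h, LinearMap.id_apply]
  rw [@norm_eq_sqrt_re_inner ℂ, this, ← @norm_eq_sqrt_re_inner ℂ]

/-- The isotypic component of an irreducible family occurring in `L`. -/
theorem exists_isotypic_block {L : α → (V →ₗ[ℂ] V)} {z : ℕ} (hz : 0 < z)
    (f₀ : EuclideanSpace ℂ (Fin z) →ₗᵢ[ℂ] V)
    {M : α → (EuclideanSpace ℂ (Fin z) →ₗ[ℂ] EuclideanSpace ℂ (Fin z))}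
    (hf₀ : Intertwines L M f₀.toLinearMap) (hM : IsIrreducibleFamily M) :
    ∃ B : ReducingBlock L, ∀ T, Intertwines L L T →
      ∃ A, T ∘ₗ B.W.toLinearMap = B.W.toLinearMap ∘ₗ TensorProduct.map A LinearMap.id := by
  have : Nontrivial (EuclideanSpace ℂ (Fin z)) := by
    refine Module.nontrivial_of_finrank_pos (R := ℂ) ?_
    rw [finrank_euclideanSpace_fin]; exact hz
  -- A unit reference vector. Evaluation at `e` embeds the space `H` of intertwiners into `V`, and
  -- by Schur's lemma `f* g` is the scalar `⟪f e, g e⟫`.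
  let e : EuclideanSpace ℂ (Fin z) := EuclideanSpace.single ⟨0, hz⟩ 1
  have he : ⟪e, e⟫_ℂ = 1 := by simp [e]
  let H : Submodule ℂ (EuclideanSpace ℂ (Fin z) →ₗ[ℂ] V) :=
    { carrier := {f | Intertwines L M f}
      add_mem' := fun {f g} hf hg a => by
        simp only [LinearMap.comp_add, LinearMap.add_comp, (hf a).1, (hf a).2, (hg a).1, (hg a).2,
          and_self]
      zero_mem' := fun a => by simp
      smul_mem' := fun c f hf a => by
        simp only [LinearMap.comp_smul, LinearMap.smul_comp, (hf a).1, (hf a).2, and_self] }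
  have hH : ∀ f, f ∈ H ↔ Intertwines L M f := fun f => Iff.rfl
  have schur : ∀ f ∈ H, ∀ g ∈ H, LinearMap.adjoint f ∘ₗ g = ⟪f e, g e⟫_ℂ • LinearMap.id := by
    intro f hf g hg
    obtain ⟨c, hc⟩ := hM.eq_smul_id (((hH f).1 hf).adjoint.comp ((hH g).1 hg))
    rw [hc]
    congr 1
    rw [← LinearMap.adjoint_inner_right, ← LinearMap.comp_apply, hc, LinearMap.smul_apply,
      inner_smul_right, LinearMap.id_apply, he, mul_one]
  let ev : H →ₗ[ℂ] V := (LinearMap.applyₗ e) ∘ₗ H.subtype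
  have hev : ∀ f : H, ev f = f.1 e := fun f => rfl
  have hinj : Function.Injective ev := by
    refine (injective_iff_map_eq_zero ev).2 fun f hf => ?_
    rw [hev] at hf
    have h1 := schur f.1 f.2 f.1 f.2
    rw [hf, inner_zero_left, zero_smul] at h1
    refine Subtype.ext (LinearMap.ext fun x => ?_)
    have h2 : ⟪f.1 x, f.1 x⟫_ℂ = 0 := by
      rw [← LinearMap.adjoint_inner_right, ← LinearMap.comp_apply, h1]; simp
    simpa using h2
  -- The multiplicity space, modelled inside `V` as all `f e`. Its inherited inner product is the
  -- one that makes `y ⊗ x ↦ (F y) x` isometric.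
  let R := LinearMap.range ev
  let eqv : H ≃ₗ[ℂ] R := LinearEquiv.ofInjective ev hinj
  let b := stdOrthonormalBasis ℂ R
  let F : EuclideanSpace ℂ (Fin (Module.finrank ℂ R)) ≃ₗ[ℂ] H :=
    b.repr.symm.toLinearEquiv.trans eqv.symm
  have hFe : ∀ y, (F y).1 e = (b.repr.symm y : V) := fun y => by
    rw [← hev]
    exact congrArg Subtype.val (eqv.apply_symm_apply (b.repr.symm y))
  have hFF : ∀ y y', LinearMap.adjoint (F y).1 ∘ₗ (F y').1 = ⟪y, y'⟫_ℂ • LinearMap.id := by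
    intro y y'
    rw [schur _ (F y).2 _ (F y').2, hFe, hFe, ← Submodule.coe_inner, LinearIsometryEquiv.inner_map_map]
  let W₀ := TensorProduct.lift (H.subtype ∘ₗ F.toLinearMap)
  have hW₀ : ∀ y x, W₀ (y ⊗ₜ x) = (F y).1 x := fun y x => rfl
  have hiso : LinearMap.adjoint W₀ ∘ₗ W₀ = LinearMap.id := by
    refine TensorProduct.ext' fun y x => ?_
    rw [TensorProduct.ext_iff_inner_left]
    intro y' x'
    refine (LinearMap.adjoint_inner_right W₀ _ _).trans ?_
    rw [LinearMap.id_apply, TensorProduct.inner_tmul, hW₀, hW₀, ← LinearMap.adjoint_inner_right,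
      ← LinearMap.comp_apply, hFF, LinearMap.smul_apply, inner_smul_right, LinearMap.id_apply]
  refine ⟨⟨Module.finrank ℂ R, z, ?_, hz, ⟨W₀, LinearMap.norm_apply_of_adjoint_comp_self hiso⟩, M,
    fun a => ⟨?_, ?_⟩⟩, fun T hT => ?_⟩
  · rw [Module.finrank_pos_iff]
    refine ⟨⟨0, ⟨f₀ e, ⟨f₀.toLinearMap, hf₀⟩, rfl⟩, fun h => ?_⟩⟩
    have h1 : f₀ e = 0 := (congrArg Subtype.val h).symm
    have h2 : e = 0 := by rw [← norm_eq_zero, ← f₀.norm_map, h1, norm_zero]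
    rw [h2] at he
    simp at he
  · refine TensorProduct.ext' fun y x => ?_
    exact LinearMap.congr_fun (((hH _).1 (F y).2) a).1 x
  · refine TensorProduct.ext' fun y x => ?_
    rw [TensorProduct.adjoint_map, LinearMap.adjoint_id]
    exact LinearMap.congr_fun (((hH _).1 (F y).2) a).2 x
  -- An operator in the commutant acts on intertwiners by composition, hence only on the
  -- multiplicity factor.
  · let T' : H →ₗ[ℂ] H := (LinearMap.llcomp ℂ _ _ _ T).restrict
      fun f hf => hT.comp hf
    refine ⟨F.symm.toLinearMap ∘ₗ T' ∘ₗ F.toLinearMap, TensorProduct.ext' fun y x => ?_⟩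
    change T (W₀ (y ⊗ₜ x)) = W₀ (F.symm (T' (F y)) ⊗ₜ x)
    rw [hW₀, hW₀, LinearEquiv.apply_symm_apply]
    rfl

theorem adjoint_comp_eq_zero_comm {E F : Type*} [NormedAddCommGroup E] [InnerProductSpace ℂ E]
    [FiniteDimensional ℂ E] [NormedAddCommGroup F] [InnerProductSpace ℂ F] [FiniteDimensional ℂ F]
    {f : E →ₗ[ℂ] V} {g : F →ₗ[ℂ] V} (h : LinearMap.adjoint f ∘ₗ g = 0) :
    LinearMap.adjoint g ∘ₗ f = 0 := by
  have := congrArg LinearMap.adjoint h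
  rwa [LinearMap.adjoint_comp, LinearMap.adjoint_adjoint, map_zero] at this

theorem adjoint_comp_subtype_orthogonal {E : Type*} [NormedAddCommGroup E]
    [InnerProductSpace ℂ E] [FiniteDimensional ℂ E] (W : E →ₗᵢ[ℂ] V) :
    LinearMap.adjoint W.toLinearMap ∘ₗ
      ((LinearMap.range W.toLinearMap)ᗮ.subtypeₗᵢ).toLinearMap = 0 :=
  LinearMap.ext fun x => ext_inner_left ℂ fun w => by
    rw [LinearMap.comp_apply, LinearMap.adjoint_inner_right, LinearMap.zero_apply,
      inner_zero_right]
    exact x.2 (W w) ⟨w, rfl⟩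

theorem comp_adjoint_add_subtype_orthogonal {E : Type*} [NormedAddCommGroup E]
    [InnerProductSpace ℂ E] [FiniteDimensional ℂ E] (W : E →ₗᵢ[ℂ] V) :
    W.toLinearMap ∘ₗ LinearMap.adjoint W.toLinearMap +
      ((LinearMap.range W.toLinearMap)ᗮ.subtypeₗᵢ).toLinearMap ∘ₗ
        LinearMap.adjoint ((LinearMap.range W.toLinearMap)ᗮ.subtypeₗᵢ).toLinearMap =
      LinearMap.id := by
  set ι := (LinearMap.range W.toLinearMap)ᗮ.subtypeₗᵢ
  have hW := adjoint_comp_subtype_orthogonal W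
  have hι := adjoint_comp_eq_zero_comm hW
  refine LinearMap.ext fun v => ?_
  have hmem : v - W (LinearMap.adjoint W.toLinearMap v) ∈ LinearMap.range ι.toLinearMap := by
    refine ⟨⟨v - W (LinearMap.adjoint W.toLinearMap v), ?_⟩, rfl⟩
    rintro _ ⟨w, rfl⟩
    rw [← LinearMap.adjoint_inner_right, map_sub]
    have := W.adjoint_apply_apply (LinearMap.adjoint W.toLinearMap v)
    rw [this, sub_self, inner_zero_right]
  have h1 := ι.apply_adjoint_of_mem_range hmem
  have h2 : LinearMap.adjoint ι.toLinearMap (W (LinearMap.adjoint W.toLinearMap v)) = 0 :=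
    LinearMap.congr_fun hι _
  rw [map_sub, h2, sub_zero] at h1
  change W (LinearMap.adjoint W.toLinearMap v) + ι (LinearMap.adjoint ι.toLinearMap v) = v
  rw [h1, add_sub_cancel]

end Block

set_option maxHeartbeats 1000000 in
/-- Decomposition of `V` into isotypic components of the family `L` and its adjoints: it acts as
`⨁ 1 ⊗ M i`, and its commutant as `⨁ A i ⊗ 1`. -/
theorem exists_isotypic_decomposition {α : Type*} (d : ℕ) :
    ∀ {V : Type u} [NormedAddCommGroup V] [InnerProductSpace ℂ V] [FiniteDimensional ℂ V]
      (_ : Module.finrank ℂ V = d) (L : α → (V →ₗ[ℂ] V)),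
    ∃ (n : ℕ) (B : Fin n → ReducingBlock L),
      (∀ i j, i ≠ j → LinearMap.adjoint (B i).W.toLinearMap ∘ₗ (B j).W.toLinearMap = 0) ∧
      (∑ i, (B i).W.toLinearMap ∘ₗ LinearMap.adjoint (B i).W.toLinearMap = LinearMap.id) ∧
      ∀ T, Intertwines L L T → ∀ i, ∃ A,
        T ∘ₗ (B i).W.toLinearMap = (B i).W.toLinearMap ∘ₗ TensorProduct.map A LinearMap.id := by
  induction d using Nat.strong_induction_on with
  | _ d ih =>
    intro V _ _ _ hd L
    rcases subsingleton_or_nontrivial V with hV | hV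
    · exact ⟨0, Fin.elim0, fun i => i.elim0, LinearMap.ext fun x => Subsingleton.elim _ _,
        fun T _ i => i.elim0⟩
    obtain ⟨z, hz, f₀, M, hf₀, hM⟩ := exists_irreducible L
    obtain ⟨B₀, hB₀⟩ := exists_isotypic_block hz f₀ hf₀ hM
    have hW := adjoint_comp_subtype_orthogonal B₀.W
    have hsum := comp_adjoint_add_subtype_orthogonal B₀.W
    set N := (LinearMap.range B₀.W.toLinearMap)ᗮ
    set ι := N.subtypeₗᵢ
    -- If `T*` preserves the range of the block, then `T` preserves its orthogonal complement.
    have hmem : ∀ T S, LinearMap.adjoint T ∘ₗ B₀.W.toLinearMap = B₀.W.toLinearMap ∘ₗ S →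
        ∀ x, T (ι x) ∈ LinearMap.range ι.toLinearMap := by
      intro T S hTS x
      refine ⟨⟨T (ι x), ?_⟩, rfl⟩
      rintro _ ⟨w, rfl⟩
      rw [← LinearMap.adjoint_inner_left, ← LinearMap.comp_apply, hTS]
      exact x.2 _ ⟨_, rfl⟩
    have hι : Intertwines L (fun a => compression ι (L a)) ι.toLinearMap :=
      intertwines_compression ι (fun a => hmem _ _ (B₀.intertwines a).2)
        (fun a => hmem _ _ (by rw [LinearMap.adjoint_adjoint]; exact (B₀.intertwines a).1))
    have hlt : Module.finrank ℂ N < d := by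
      have h1 := Submodule.finrank_add_finrank_orthogonal (LinearMap.range B₀.W.toLinearMap)
      have h2 : Module.finrank ℂ (LinearMap.range B₀.W.toLinearMap) = B₀.y * B₀.z := by
        rw [LinearMap.finrank_range_of_inj B₀.W.injective, Module.finrank_tensorProduct,
          finrank_euclideanSpace_fin, finrank_euclideanSpace_fin]
      have h3 := Nat.mul_pos B₀.y_pos B₀.z_pos
      rw [hd, h2] at h1
      change _ + Module.finrank ℂ N = d at h1
      omega
    obtain ⟨n, B, horth, htot, hcomm⟩ := ih _ hlt rfl (fun a => compression ι (L a))
    have horth₀ : ∀ i, LinearMap.adjoint B₀.W.toLinearMap ∘ₗ ((B i).lift ι hι).W.toLinearMap = 0 := by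
      intro i
      change LinearMap.adjoint B₀.W.toLinearMap ∘ₗ (ι.toLinearMap ∘ₗ (B i).W.toLinearMap) = 0
      rw [← LinearMap.comp_assoc, hW, LinearMap.zero_comp]
    obtain ⟨C, hC₀, hC⟩ : ∃ C : Fin (n + 1) → ReducingBlock L,
        C 0 = B₀ ∧ ∀ i : Fin n, C i.succ = (B i).lift ι hι :=
      ⟨Fin.cons B₀ fun i => (B i).lift ι hι, rfl, fun i => rfl⟩
    refine ⟨n + 1, C, fun i j => ?_, ?_, fun T hT i => ?_⟩
    · cases i using Fin.cases with
      | zero =>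
        cases j using Fin.cases with
        | zero => exact fun h => absurd rfl h
        | succ j => rw [hC₀, hC]; exact fun _ => horth₀ j
      | succ i =>
        cases j using Fin.cases with
        | zero => rw [hC₀, hC]; exact fun _ => adjoint_comp_eq_zero_comm (horth₀ i)
        | succ j =>
          intro hij
          have hij' : i ≠ j := fun h => hij (by rw [h])
          rw [hC, hC]
          exact ((B i).adjoint_lift_comp_lift (B j) ι hι).trans (horth i j hij')
    · have hs : ∀ i : Fin n, (C i.succ).W.toLinearMap ∘ₗ
          LinearMap.adjoint (C i.succ).W.toLinearMap = ι.toLinearMap ∘ₗ ((B i).W.toLinearMap ∘ₗ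
            LinearMap.adjoint (B i).W.toLinearMap) ∘ₗ LinearMap.adjoint ι.toLinearMap :=
        fun i => by rw [hC, ReducingBlock.lift_comp_adjoint]
      rw [Fin.sum_univ_succ, hC₀, Finset.sum_congr rfl fun i _ => hs i]
      have hm : ∑ i, ι.toLinearMap ∘ₗ ((B i).W.toLinearMap ∘ₗ
          LinearMap.adjoint (B i).W.toLinearMap) ∘ₗ LinearMap.adjoint ι.toLinearMap =
          ι.toLinearMap ∘ₗ (∑ i, (B i).W.toLinearMap ∘ₗ
          LinearMap.adjoint (B i).W.toLinearMap) ∘ₗ LinearMap.adjoint ι.toLinearMap := by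
        refine LinearMap.ext fun x => ?_
        simp only [LinearMap.sum_apply, LinearMap.comp_apply, map_sum]
      rw [hm, htot, LinearMap.id_comp, hsum]
    · cases i using Fin.cases with
      | zero => rw [hC₀]; exact hB₀ T hT
      | succ i =>
        rw [hC]
        -- The commutant is closed under adjoints; the block property of `T*` shows that `T`
        -- preserves `N`, so the induction applies to its compression.
        obtain ⟨A', hA'⟩ := hB₀ _ hT.adjoint
        have hTι := comp_compression ι (hmem T _ hA')
        have hT' : Intertwines (fun a => compression ι (L a)) (fun a => compression ι (L a))
            (compression ι T) := hι.adjoint.comp (hT.comp hι)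
        obtain ⟨A, hA⟩ := hcomm _ hT' i
        refine ⟨A, ?_⟩
        exact (B i).comp_lift ι hι hTι hA

/-! ### Kraus maps and positivity under conjugation, tensoring and orthogonal sums. -/

section Conj

variable {α : Type*} [Fintype α]
variable {V Z : Type*} [NormedAddCommGroup V] [InnerProductSpace ℂ V] [FiniteDimensional ℂ V]
  [NormedAddCommGroup Z] [InnerProductSpace ℂ Z] [FiniteDimensional ℂ Z]

/-- Only `L a f = f (M a)` is needed, with no condition on the adjoints. This matters for the
support of a fixed point, which is shown invariant under the Kraus operators but not under their
adjoints. -/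
theorem krausMap_conj {L : α → (V →ₗ[ℂ] V)} {M : α → (Z →ₗ[ℂ] Z)} {f : Z →ₗ[ℂ] V}
    (h : ∀ a, L a ∘ₗ f = f ∘ₗ M a) (X : Z →ₗ[ℂ] Z) :
    krausMap L (f ∘ₗ X ∘ₗ LinearMap.adjoint f) =
      f ∘ₗ krausMap M X ∘ₗ LinearMap.adjoint f := by
  have h' : ∀ a, LinearMap.adjoint f ∘ₗ LinearMap.adjoint (L a) =
      LinearMap.adjoint (M a) ∘ₗ LinearMap.adjoint f := fun a => by
    rw [← LinearMap.adjoint_comp, h, LinearMap.adjoint_comp]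
  refine LinearMap.ext fun x => ?_
  simp only [krausMap_apply, LinearMap.sum_apply, LinearMap.comp_apply, map_sum,
    Module.End.mul_apply, LinearMap.star_eq_adjoint]
  refine Finset.sum_congr rfl fun a _ => ?_
  have h1 := fun v => LinearMap.congr_fun (h a) v
  have h2 := fun v => LinearMap.congr_fun (h' a) v
  simp only [LinearMap.comp_apply] at h1 h2
  rw [h1, h2]

/-- The factor `S` makes positivity of `1 ⊗ ρ` visible, as `(1 ⊗ S)* (1 ⊗ S)`. -/
theorem LinearMap.IsPositive.exists_eq_adjoint_comp_self {ρ : Z →ₗ[ℂ] Z} (hρ : ρ.IsPositive) :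
    ∃ S : Z →ₗ[ℂ] EuclideanSpace ℂ (Fin (Module.finrank ℂ Z)),
      ρ = LinearMap.adjoint S ∘ₗ S := by
  obtain ⟨c, hc⟩ := hρ.exists_eq_sum_inner_smul
  let e := EuclideanSpace.basisFun (Fin (Module.finrank ℂ Z)) ℂ
  refine ⟨∑ a, (InnerProductSpace.rankOne ℂ (e a) (c a)).toLinearMap, ?_⟩
  refine LinearMap.ext fun y => ext_inner_left ℂ fun x => ?_
  rw [LinearMap.comp_apply, LinearMap.adjoint_inner_right, hc]
  simp only [LinearMap.sum_apply, ContinuousLinearMap.coe_coe, InnerProductSpace.rankOne_apply,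
    e.orthonormal.inner_sum, inner_sum, inner_smul_right, inner_conj_symm]
  exact Finset.sum_congr rfl fun a _ => mul_comm _ _

theorem LinearMap.IsPositive.map_id {Y : Type*} [NormedAddCommGroup Y] [InnerProductSpace ℂ Y]
    [FiniteDimensional ℂ Y] {ρ : Z →ₗ[ℂ] Z} (hρ : ρ.IsPositive) :
    (TensorProduct.map (LinearMap.id : Y →ₗ[ℂ] Y) ρ).IsPositive := by
  obtain ⟨S, hS⟩ := hρ.exists_eq_adjoint_comp_self
  have : TensorProduct.map (LinearMap.id : Y →ₗ[ℂ] Y) ρ =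
      LinearMap.adjoint (TensorProduct.map (LinearMap.id : Y →ₗ[ℂ] Y) S) ∘ₗ
        TensorProduct.map (LinearMap.id : Y →ₗ[ℂ] Y) S := by
    rw [TensorProduct.adjoint_map, LinearMap.adjoint_id, ← TensorProduct.map_comp, ← hS,
      LinearMap.id_comp]
  rw [this]
  exact LinearMap.isPositive_adjoint_comp_self _

theorem krausMap_map {Y : Type*} [NormedAddCommGroup Y] [InnerProductSpace ℂ Y]
    [FiniteDimensional ℂ Y] (M : α → (Z →ₗ[ℂ] Z)) (A : Y →ₗ[ℂ] Y) (ρ : Z →ₗ[ℂ] Z) :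
    krausMap (fun a => TensorProduct.map (LinearMap.id : Y →ₗ[ℂ] Y) (M a))
      (TensorProduct.map A ρ) = TensorProduct.map A (krausMap M ρ) := by
  refine TensorProduct.ext' fun y x => ?_
  simp only [krausMap_apply, LinearMap.sum_apply, Module.End.mul_apply,
    LinearMap.star_eq_adjoint, TensorProduct.adjoint_map, TensorProduct.map_tmul,
    LinearMap.adjoint_id, LinearMap.id_apply, TensorProduct.tmul_sum]

theorem LinearMap.IsPositive.compression_isPositive {σ : V →ₗ[ℂ] V} (hσ : σ.IsPositive)
    (g : Z →ₗᵢ[ℂ] V) : (compression g σ).IsPositive :=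
  hσ.adjoint_conj g.toLinearMap

theorem LinearMap.IsPositive.compression_injective {σ : V →ₗ[ℂ] V} (hσ : σ.IsPositive)
    (g : Z →ₗᵢ[ℂ] V) (hg : ∀ x, σ (g x) = 0 → x = 0) :
    Function.Injective (compression g σ) := by
  refine (injective_iff_map_eq_zero _).2 fun x hx => hg x ?_
  refine hσ.apply_eq_zero_of_inner ?_
  change ⟪g.toLinearMap x, _⟫_ℂ = 0
  rw [← LinearMap.adjoint_inner_right]
  change ⟪x, compression g σ x⟫_ℂ = 0
  rw [hx, inner_zero_right]

omit [FiniteDimensional ℂ V] in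
theorem exists_left_inverse_of_injective {T : V →ₗ[ℂ] V} (hT : Function.Injective T) :
    ∃ s : V →ₗ[ℂ] V, s * T = 1 :=
  LinearMap.exists_leftInverse_of_injective T (LinearMap.ker_eq_bot.2 hT)

/-- A nonzero positive operator rescaled to trace one. -/
theorem LinearMap.IsPositive.isDensityOperator_smul {ρ : Z →ₗ[ℂ] Z} (hρ : ρ.IsPositive)
    (h0 : ρ ≠ 0) : IsDensityOperator ((LinearMap.trace ℂ Z ρ)⁻¹ • ρ) where
  isPositive := hρ.smul_of_nonneg (inv_nonneg.2 hρ.trace_nonneg)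
  trace_eq_one := by
    rw [map_smul, smul_eq_mul, inv_mul_cancel₀]
    exact fun h => h0 (hρ.eq_zero_of_trace h)

theorem sum_conj_mul_sum_conj {n : ℕ} {E : Fin n → Type*} [∀ i, NormedAddCommGroup (E i)]
    [∀ i, InnerProductSpace ℂ (E i)] [∀ i, FiniteDimensional ℂ (E i)]
    (W : ∀ i, E i →ₗᵢ[ℂ] V)
    (horth : ∀ i j, i ≠ j → LinearMap.adjoint (W i).toLinearMap ∘ₗ (W j).toLinearMap = 0)
    (X Y : ∀ i, E i →ₗ[ℂ] E i) :
    (∑ i, (W i).toLinearMap ∘ₗ X i ∘ₗ LinearMap.adjoint (W i).toLinearMap) *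
      (∑ i, (W i).toLinearMap ∘ₗ Y i ∘ₗ LinearMap.adjoint (W i).toLinearMap) =
      ∑ i, (W i).toLinearMap ∘ₗ (X i ∘ₗ Y i) ∘ₗ LinearMap.adjoint (W i).toLinearMap := by
  rw [Finset.sum_mul_sum]
  refine Finset.sum_congr rfl fun i _ => ?_
  rw [Finset.sum_eq_single i]
  · refine LinearMap.ext fun x => ?_
    exact congrArg (fun v => W i (X i v)) ((W i).adjoint_apply_apply _)
  · intro j _ hji
    refine LinearMap.ext fun x => ?_
    have := LinearMap.congr_fun (horth i j hji.symm) (Y j (LinearMap.adjoint (W j).toLinearMap x))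
    simp only [LinearMap.comp_apply, LinearMap.zero_apply] at this
    simp only [Module.End.mul_apply, LinearMap.comp_apply, this, map_zero, LinearMap.zero_apply]
  · exact fun h => absurd (Finset.mem_univ i) h

end Conj

/-! ### Channels with an invertible fixed point. -/

section Faithful

variable {α : Type*} [Fintype α]
variable {V : Type u} [NormedAddCommGroup V] [InnerProductSpace ℂ V] [FiniteDimensional ℂ V]

/-- The operator `W (A ⊗ ρ) W*` on `V` supported on a block. -/
noncomputable abbrev ReducingBlock.op {L : α → (V →ₗ[ℂ] V)} (B : ReducingBlock L)
    (A : EuclideanSpace ℂ (Fin B.y) →ₗ[ℂ] EuclideanSpace ℂ (Fin B.y))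
    (ρ : EuclideanSpace ℂ (Fin B.z) →ₗ[ℂ] EuclideanSpace ℂ (Fin B.z)) : V →ₗ[ℂ] V :=
  B.W.toLinearMap ∘ₗ TensorProduct.map A ρ ∘ₗ LinearMap.adjoint B.W.toLinearMap

theorem ReducingBlock.krausMap_op {L : α → (V →ₗ[ℂ] V)} (B : ReducingBlock L)
    (A : EuclideanSpace ℂ (Fin B.y) →ₗ[ℂ] EuclideanSpace ℂ (Fin B.y))
    (ρ : EuclideanSpace ℂ (Fin B.z) →ₗ[ℂ] EuclideanSpace ℂ (Fin B.z)) :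
    krausMap L (B.op A ρ) = B.op A (krausMap B.M ρ) := by
  rw [ReducingBlock.op, krausMap_conj (fun a => (B.intertwines a).1), krausMap_map]

/-- Each block carries a faithful density operator fixed by the channel with Kraus operators `M`. -/
theorem ReducingBlock.exists_density {L : α → (V →ₗ[ℂ] V)} (B : ReducingBlock L)
    {σ : V →ₗ[ℂ] V} (hσ : σ.IsPositive) (hinj : Function.Injective σ)
    (hfix : krausMap L σ = σ) :
    ∃ ρ : EuclideanSpace ℂ (Fin B.z) →ₗ[ℂ] EuclideanSpace ℂ (Fin B.z),
      IsDensityOperator ρ ∧ Function.Injective ρ ∧ krausMap B.M ρ = ρ := by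
  have : Nontrivial (EuclideanSpace ℂ (Fin B.z)) := by
    refine Module.nontrivial_of_finrank_pos (R := ℂ) ?_
    rw [finrank_euclideanSpace_fin]; exact B.z_pos
  let e : EuclideanSpace ℂ (Fin B.y) := EuclideanSpace.single ⟨0, B.y_pos⟩ 1
  have he : ‖e‖ = 1 := by simp [e]
  -- The slice `x ↦ e ⊗ x` of the block; any unit vector `e` would do. It intertwines `L` with `M`,
  -- so compressing `σ` along it gives a fixed point of the channel of `M`.
  let w : EuclideanSpace ℂ (Fin B.z) →ₗᵢ[ℂ] V :=
    ⟨B.W.toLinearMap ∘ₗ TensorProduct.mk ℂ _ _ e, fun x => by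
      change ‖B.W (e ⊗ₜ x)‖ = _
      rw [B.W.norm_map, TensorProduct.norm_tmul, he, one_mul]⟩
  have hw : Intertwines L B.M w.toLinearMap := by
    refine fun a => ⟨LinearMap.ext fun x => ?_, LinearMap.ext fun x => ?_⟩
    · exact LinearMap.congr_fun (B.intertwines a).1 (e ⊗ₜ x)
    · have := LinearMap.congr_fun (B.intertwines a).2 (e ⊗ₜ x)
      rw [TensorProduct.adjoint_map, LinearMap.adjoint_id] at this
      exact this
  have hpos := hσ.compression_isPositive w
  have hi := hσ.compression_injective w fun x hx => by
    have h1 : w x = 0 := (injective_iff_map_eq_zero σ).1 hinj _ hx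
    rw [← norm_eq_zero, ← w.norm_map, h1, norm_zero]
  have hf : krausMap B.M (compression w σ) = compression w σ := by
    have := krausMap_conj (fun a => (hw.adjoint a).1) σ
    rw [LinearMap.adjoint_adjoint, hfix] at this
    exact this
  have h0 : compression w σ ≠ 0 := by
    intro h
    obtain ⟨x, hx⟩ := exists_ne (0 : EuclideanSpace ℂ (Fin B.z))
    exact hx (hi (by rw [h, LinearMap.zero_apply, map_zero]))
  have ht : (LinearMap.trace ℂ _ (compression w σ))⁻¹ ≠ 0 :=
    inv_ne_zero fun h => h0 (hpos.eq_zero_of_trace h)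
  refine ⟨_, hpos.isDensityOperator_smul h0, ?_, by rw [map_smul, hf]⟩
  exact fun x y hxy => hi (smul_right_injective _ ht hxy)

/-- Structure of the fixed points of a channel with a faithful fixed point. -/
theorem exists_fixed_structure_of_faithful {L : α → (V →ₗ[ℂ] V)}
    (hL : ∑ a, star (L a) * L a = 1) {σ : V →ₗ[ℂ] V} (hσ : σ.IsPositive)
    (hinj : Function.Injective σ) (hfix : krausMap L σ = σ) :
    ∃ (n : ℕ) (B : Fin n → ReducingBlock L)
      (ρ : ∀ i, EuclideanSpace ℂ (Fin (B i).z) →ₗ[ℂ] EuclideanSpace ℂ (Fin (B i).z)),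
      (∀ i j, i ≠ j → LinearMap.adjoint (B i).W.toLinearMap ∘ₗ (B j).W.toLinearMap = 0) ∧
      (∀ i, IsDensityOperator (ρ i) ∧ Function.Injective (ρ i)) ∧
      (∀ i A, krausMap L ((B i).op A (ρ i)) = (B i).op A (ρ i)) ∧
      ∀ X, krausMap L X = X → ∃ A : ∀ i, EuclideanSpace ℂ (Fin (B i).y) →ₗ[ℂ] _,
        X = ∑ i, (B i).op (A i) (ρ i) := by
  obtain ⟨n, B, horth, htot, hcomm⟩ := exists_isotypic_decomposition _ rfl L
  choose ρ hρ hρi hρf using fun i => (B i).exists_density hσ hinj hfix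
  have hop : ∀ i A, krausMap L ((B i).op A (ρ i)) = (B i).op A (ρ i) := fun i A => by
    rw [(B i).krausMap_op, hρf]
  refine ⟨n, B, ρ, horth, fun i => ⟨hρ i, hρi i⟩, hop, fun X hX => ?_⟩
  choose s hs using fun i => exists_left_inverse_of_injective (hρi i)
  -- `σ` itself need not be of the form `⨁ 1 ⊗ ρ i`; `τ` is, and it is again an invertible positive
  -- fixed point, so it replaces `σ` in the commutation argument.
  set τ := ∑ i, (B i).op LinearMap.id (ρ i) with hτdef
  have hτ : τ.IsPositive := LinearMap.isPositive_sum _ fun i _ =>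
    (hρ i).isPositive.map_id.conj_adjoint (B i).W.toLinearMap
  have hτf : krausMap L τ = τ := by
    rw [map_sum]
    exact Finset.sum_congr rfl fun i _ => hop i _
  -- Invertibility is checked blockwise; the blocks exhaust the space by `htot`.
  have hτs : (∑ i, (B i).op LinearMap.id (s i)) * τ = 1 := by
    refine (sum_conj_mul_sum_conj (fun i => (B i).W) horth _ _).trans ?_
    refine Eq.trans (Finset.sum_congr rfl fun i _ => ?_) htot
    rw [← TensorProduct.map_comp, ← Module.End.mul_eq_comp (s i), hs, Module.End.one_eq_id,
      LinearMap.id_comp, TensorProduct.map_id, LinearMap.id_comp]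
  obtain ⟨x, hx, hx1, hx2⟩ := exists_commute_of_fixed hL hτ hτf hτs hX
  have hxL : Intertwines L L x := fun a => ⟨(hx1 a).symm, by
    rw [← LinearMap.star_eq_adjoint]; exact (hx2 a).symm⟩
  choose A hA using hcomm x hxL
  refine ⟨A, ?_⟩
  rw [hx, hτdef, Finset.mul_sum]
  refine Finset.sum_congr rfl fun i _ => ?_
  have h1 : TensorProduct.map (A i) (ρ i) = TensorProduct.map (A i) LinearMap.id ∘ₗ
      TensorProduct.map LinearMap.id (ρ i) := by
    rw [← TensorProduct.map_comp, LinearMap.comp_id, LinearMap.id_comp]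
  rw [Module.End.mul_eq_comp, ReducingBlock.op, ReducingBlock.op, h1, ← LinearMap.comp_assoc, hA,
    LinearMap.comp_assoc, LinearMap.comp_assoc]

end Faithful

/-! ### Restriction to the support of a maximal fixed point. -/

section Support

variable {α : Type*} [Fintype α]
variable {V : Type*} [NormedAddCommGroup V] [InnerProductSpace ℂ V] [FiniteDimensional ℂ V]

/-- The adjoints of the Kraus operators preserve the kernel of a positive fixed point. -/
theorem apply_adjoint_eq_zero_of_fixed {K : α → (V →ₗ[ℂ] V)} {σ : V →ₗ[ℂ] V}
    (hσ : σ.IsPositive) (hfix : krausMap K σ = σ) {k : V} (hk : σ k = 0) (a : α) :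
    σ (LinearMap.adjoint (K a) k) = 0 := by
  have h1 : ∑ a, ⟪k, (K a * σ * star (K a)) k⟫_ℂ = 0 := by
    rw [← inner_sum, ← LinearMap.sum_apply, ← krausMap_apply, hfix, hk, inner_zero_right]
  have h2 := (Finset.sum_eq_zero_iff_of_nonneg
    (fun b _ => (hσ.mul_mul_star (K b)).inner_nonneg_right k)).1 h1 a (Finset.mem_univ a)
  refine hσ.apply_eq_zero_of_inner ?_
  rw [LinearMap.adjoint_inner_left, ← LinearMap.star_eq_adjoint]
  exact h2

theorem comp_comp_adjoint_eq_self {Z : Type*} [NormedAddCommGroup Z] [InnerProductSpace ℂ Z]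
    [FiniteDimensional ℂ Z] (ι : Z →ₗᵢ[ℂ] V) {T : V →ₗ[ℂ] V}
    (hT : ∀ v ∈ (LinearMap.range ι.toLinearMap)ᗮ, T v = 0) (v : V) :
    T (ι (LinearMap.adjoint ι.toLinearMap v)) = T v := by
  have h := LinearMap.congr_fun (comp_adjoint_add_subtype_orthogonal ι) v
  conv_rhs => rw [← LinearMap.id_apply (R := ℂ) v, ← h]
  rw [LinearMap.add_apply, map_add]
  refine (add_eq_left.2 (hT _ ?_)).symm
  exact Subtype.prop (LinearMap.adjoint
    ((LinearMap.range ι.toLinearMap)ᗮ.subtypeₗᵢ).toLinearMap v)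

theorem conj_compression_eq_self {Z : Type*} [NormedAddCommGroup Z] [InnerProductSpace ℂ Z]
    [FiniteDimensional ℂ Z] (ι : Z →ₗᵢ[ℂ] V) {T : V →ₗ[ℂ] V}
    (hT : ∀ v ∈ (LinearMap.range ι.toLinearMap)ᗮ, T v = 0)
    (hT' : ∀ v ∈ (LinearMap.range ι.toLinearMap)ᗮ, LinearMap.adjoint T v = 0) :
    ι.toLinearMap ∘ₗ compression ι T ∘ₗ LinearMap.adjoint ι.toLinearMap = T := by
  refine LinearMap.ext fun v => ext_inner_right ℂ fun w => ?_
  change ⟪ι.toLinearMap (LinearMap.adjoint ι.toLinearMap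
    (T (ι (LinearMap.adjoint ι.toLinearMap v)))), w⟫_ℂ = _
  rw [comp_comp_adjoint_eq_self ι hT, ← LinearMap.adjoint_inner_right,
    LinearMap.adjoint_inner_left, ← LinearMap.adjoint_inner_right]
  change ⟪v, LinearMap.adjoint T (ι (LinearMap.adjoint ι.toLinearMap w))⟫_ℂ = _
  rw [comp_comp_adjoint_eq_self ι hT', LinearMap.adjoint_inner_right]

theorem compression_conj {Z : Type*} [NormedAddCommGroup Z] [InnerProductSpace ℂ Z]
    [FiniteDimensional ℂ Z] (ι : Z →ₗᵢ[ℂ] V) (X : Z →ₗ[ℂ] Z) :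
    compression ι (ι.toLinearMap ∘ₗ X ∘ₗ LinearMap.adjoint ι.toLinearMap) = X := by
  refine LinearMap.ext fun x => ?_
  change LinearMap.adjoint ι.toLinearMap (ι (X (LinearMap.adjoint ι.toLinearMap (ι x)))) = X x
  rw [ι.adjoint_apply_apply, ι.adjoint_apply_apply]

/-- A channel restricts to a channel with a faithful fixed point on the subspace supporting its
fixed points. -/
theorem exists_faithful_restriction {K : α → (V →ₗ[ℂ] V)} (hK : ∑ a, star (K a) * K a = 1) :
    ∃ (S : Submodule ℂ V) (L : α → (S →ₗ[ℂ] S)) (σ : S →ₗ[ℂ] S),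
      ∑ a, star (L a) * L a = 1 ∧ σ.IsPositive ∧ Function.Injective σ ∧ krausMap L σ = σ ∧
      (∀ X, krausMap K (S.subtypeₗᵢ.toLinearMap ∘ₗ X ∘ₗ
        LinearMap.adjoint S.subtypeₗᵢ.toLinearMap) = S.subtypeₗᵢ.toLinearMap ∘ₗ krausMap L X ∘ₗ
        LinearMap.adjoint S.subtypeₗᵢ.toLinearMap) ∧
      ∀ μ, krausMap K μ = μ → ∃ X, krausMap L X = X ∧ μ = S.subtypeₗᵢ.toLinearMap ∘ₗ X ∘ₗ
        LinearMap.adjoint S.subtypeₗᵢ.toLinearMap := by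
  obtain ⟨σ, hσ, hfix, hker⟩ := exists_isPositive_fixed_ker_le hK
  set S := σ.kerᗮ
  set ι := S.subtypeₗᵢ
  have hrange : LinearMap.range ι.toLinearMap = S := S.range_subtype
  have horth : ∀ v ∈ (LinearMap.range ι.toLinearMap)ᗮ, σ v = 0 := by
    intro v hv
    rw [hrange, Submodule.orthogonal_orthogonal] at hv
    exact hv
  -- The adjoints `(K a)*` preserve `ker σ`, so the `K a` preserve its orthogonal complement `S`.
  have hKι : ∀ a, K a ∘ₗ ι.toLinearMap = ι.toLinearMap ∘ₗ compression ι (K a) := by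
    refine fun a => comp_compression ι fun x => ?_
    rw [hrange]
    intro k hk
    rw [← LinearMap.adjoint_inner_left]
    exact x.2 _ (apply_adjoint_eq_zero_of_fixed hσ hfix hk a)
  have hconj := krausMap_conj hKι
  have hfixed : ∀ μ, krausMap K μ = μ →
      ι.toLinearMap ∘ₗ compression ι μ ∘ₗ LinearMap.adjoint ι.toLinearMap = μ := by
    -- Both `μ` and `μ*` are fixed, so both vanish on `ker σ`, and `μ` is recovered from its
    -- compression to `S`.
    refine fun μ hμ => conj_compression_eq_self ι (fun v hv => hker μ hμ (horth v hv))
      fun v hv => hker _ ?_ (horth v hv)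
    rw [← LinearMap.star_eq_adjoint, ← star_krausMap, hμ]
  have hcfix : ∀ μ, krausMap K μ = μ →
      krausMap (fun a => compression ι (K a)) (compression ι μ) = compression ι μ := by
    intro μ hμ
    have h := hconj (compression ι μ)
    rw [hfixed μ hμ, hμ] at h
    rw [← compression_conj ι (krausMap _ _), ← h]
  refine ⟨S, fun a => compression ι (K a), compression ι σ, ?_, hσ.compression_isPositive ι,
    hσ.compression_injective ι fun x hx => ?_, hcfix σ hfix, hconj,
    fun μ hμ => ⟨compression ι μ, hcfix μ hμ, (hfixed μ hμ).symm⟩⟩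
  -- The compressions remain trace-preserving because `K a` maps `S` into `S`, so no part of `K a x`
  -- is lost.
  · refine LinearMap.ext fun x => ext_inner_left ℂ fun y => ?_
    have h1 : ∀ a, ⟪y, (star (compression ι (K a)) * compression ι (K a)) x⟫_ℂ =
        ⟪ι y, (star (K a) * K a) (ι x)⟫_ℂ := by
      intro a
      rw [Module.End.mul_apply, Module.End.mul_apply, LinearMap.star_eq_adjoint,
        LinearMap.star_eq_adjoint, LinearMap.adjoint_inner_right, LinearMap.adjoint_inner_right,
        ← ι.inner_map_map]
      have h2 := LinearMap.congr_fun (hKι a)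
      simp only [LinearMap.comp_apply] at h2
      exact congrArg₂ (fun v w => ⟪v, w⟫_ℂ) (h2 y).symm (h2 x).symm
    rw [LinearMap.sum_apply, inner_sum, Finset.sum_congr rfl fun a _ => h1 a, ← inner_sum,
      ← LinearMap.sum_apply, hK, Module.End.one_apply, Module.End.one_apply, ι.inner_map_map]
  · have h1 : (x : V) ∈ σ.ker := hx
    have h2 := x.2 _ h1
    exact Subtype.ext (inner_self_eq_zero.1 h2)

end Support

/-! ### Independence of the block spaces and the final assembly. -/

section BlockSpace

variable {V : Type*} [NormedAddCommGroup V] [InnerProductSpace ℂ V] [FiniteDimensional ℂ V]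

theorem sum_mem_iSup_blockSpace {ι : Type*} [Fintype ι] {Y Z : ι → Type*}
    [∀ i, NormedAddCommGroup (Y i)] [∀ i, InnerProductSpace ℂ (Y i)]
    [∀ i, FiniteDimensional ℂ (Y i)] [∀ i, NormedAddCommGroup (Z i)]
    [∀ i, InnerProductSpace ℂ (Z i)] [∀ i, FiniteDimensional ℂ (Z i)]
    (W : ∀ i, (Y i ⊗[ℂ] Z i) →ₗᵢ[ℂ] V) (ρ : ∀ i, Z i →ₗ[ℂ] Z i) (A : ∀ i, Y i →ₗ[ℂ] Y i) :
    ∑ i, (W i).toLinearMap ∘ₗ TensorProduct.map (A i) (ρ i) ∘ₗ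
      LinearMap.adjoint (W i).toLinearMap ∈ ⨆ i, blockSpace (W i) (ρ i) :=
  Submodule.sum_mem _ fun i _ => Submodule.mem_iSup_of_mem i ⟨A i, rfl⟩

/-- Left multiplication by `(W i)*` annihilates every other block, while `(W i)* W i = 1` makes it
injective on block `i`. -/
theorem iSupIndep_blockSpace {ι : Type*} {Y Z : ι → Type*}
    [∀ i, NormedAddCommGroup (Y i)] [∀ i, InnerProductSpace ℂ (Y i)]
    [∀ i, FiniteDimensional ℂ (Y i)] [∀ i, NormedAddCommGroup (Z i)]
    [∀ i, InnerProductSpace ℂ (Z i)] [∀ i, FiniteDimensional ℂ (Z i)]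
    (W : ∀ i, (Y i ⊗[ℂ] Z i) →ₗᵢ[ℂ] V) (ρ : ∀ i, Z i →ₗ[ℂ] Z i)
    (horth : ∀ i j, i ≠ j → LinearMap.adjoint (W i).toLinearMap ∘ₗ (W j).toLinearMap = 0) :
    iSupIndep fun i => blockSpace (W i) (ρ i) := by
  intro i
  rw [Submodule.disjoint_def]
  rintro _ ⟨A, rfl⟩ hx
  let p : (V →ₗ[ℂ] V) →ₗ[ℂ] (V →ₗ[ℂ] (Y i ⊗[ℂ] Z i)) :=
    LinearMap.llcomp ℂ _ _ _ (LinearMap.adjoint (W i).toLinearMap)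
  have hle : ⨆ j, ⨆ _ : j ≠ i, blockSpace (W j) (ρ j) ≤ p.ker := by
    refine iSup₂_le fun j hj => ?_
    rintro _ ⟨A, rfl⟩
    rw [LinearMap.mem_ker]
    refine LinearMap.ext fun v => ?_
    exact LinearMap.congr_fun (horth i j hj.symm) _
  have h := LinearMap.mem_ker.1 (hle hx)
  refine LinearMap.ext fun v => ?_
  have h1 := LinearMap.congr_fun h v
  have h2 := (W i).adjoint_apply_apply
    (TensorProduct.map A (ρ i) (LinearMap.adjoint (W i).toLinearMap v))
  have h3 : TensorProduct.map A (ρ i) (LinearMap.adjoint (W i).toLinearMap v) = 0 :=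
    h2.symm.trans h1
  simp only [LinearMap.comp_apply, h3, map_zero, LinearMap.zero_apply]

end BlockSpace

theorem theorem1 {V : Type*} [NormedAddCommGroup V] [InnerProductSpace ℂ V]
    [FiniteDimensional ℂ V] (Ψ : SuperOp V) (hΨ : IsCPTP Ψ) :
    ∃ (n : ℕ) (y z : Fin n → ℕ)
      (W : ∀ i : Fin n,
        (EuclideanSpace ℂ (Fin (y i)) ⊗[ℂ] EuclideanSpace ℂ (Fin (z i))) →ₗᵢ[ℂ] V)
      (ρ : ∀ i : Fin n, EuclideanSpace ℂ (Fin (z i)) →ₗ[ℂ] EuclideanSpace ℂ (Fin (z i))),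
      OrthogonalFamily ℂ
        (fun i => EuclideanSpace ℂ (Fin (y i)) ⊗[ℂ] EuclideanSpace ℂ (Fin (z i))) W ∧
      (∀ i, IsDensityOperator (ρ i) ∧ (ρ i).rank = z i) ∧
      iSupIndep (fun i => blockSpace (W i) (ρ i)) ∧
      fixedSpace Ψ = ⨆ i, blockSpace (W i) (ρ i) := by
  obtain ⟨m, K, rfl⟩ := hΨ.isCompletelyPositive.exists_eq_krausMap
  have hK := sum_star_mul_eq_one_of_isTracePreserving hΨ.isTracePreserving
  obtain ⟨S, L, σ, hL, hσ, hσi, hσf, hconj, hfixed⟩ := exists_faithful_restriction hK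
  obtain ⟨n, B, ρ, horth, hρ, hop, hall⟩ := exists_fixed_structure_of_faithful hL hσ hσi hσf
  let W := fun i => S.subtypeₗᵢ.comp (B i).W
  have horthW : ∀ i j, i ≠ j → LinearMap.adjoint (W i).toLinearMap ∘ₗ (W j).toLinearMap = 0 :=
    fun i j hij => (S.subtypeₗᵢ.adjoint_comp_comp_comp (B i).W (B j).W).trans (horth i j hij)
  have hW : ∀ i A, (W i).toLinearMap ∘ₗ TensorProduct.map A (ρ i) ∘ₗ
      LinearMap.adjoint (W i).toLinearMap = S.subtypeₗᵢ.toLinearMap ∘ₗ (B i).op A (ρ i) ∘ₗ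
        LinearMap.adjoint S.subtypeₗᵢ.toLinearMap := by
    intro i A
    change (S.subtypeₗᵢ.toLinearMap ∘ₗ (B i).W.toLinearMap) ∘ₗ TensorProduct.map A (ρ i) ∘ₗ
      LinearMap.adjoint (S.subtypeₗᵢ.toLinearMap ∘ₗ (B i).W.toLinearMap) = _
    rw [LinearMap.adjoint_comp]
    simp only [LinearMap.comp_assoc]
  refine ⟨n, fun i => (B i).y, fun i => (B i).z, W, ρ, ?_, fun i => ⟨(hρ i).1, ?_⟩,
    iSupIndep_blockSpace W ρ horthW, le_antisymm ?_ (iSup_le fun i => ?_)⟩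
  · intro i j hij v w
    change ⟪(W i).toLinearMap v, (W j).toLinearMap w⟫_ℂ = 0
    rw [← LinearMap.adjoint_inner_right, ← LinearMap.comp_apply, horthW i j hij,
      LinearMap.zero_apply, inner_zero_right]
  · rw [LinearMap.rank, rank_range_of_injective _ (hρ i).2, ← Module.finrank_eq_rank,
      finrank_euclideanSpace_fin]
  · intro μ hμ
    obtain ⟨X, hX, rfl⟩ := hfixed μ hμ
    obtain ⟨A, rfl⟩ := hall X hX
    have : S.subtypeₗᵢ.toLinearMap ∘ₗ (∑ i, (B i).op (A i) (ρ i)) ∘ₗ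
        LinearMap.adjoint S.subtypeₗᵢ.toLinearMap = ∑ i, (W i).toLinearMap ∘ₗ
        TensorProduct.map (A i) (ρ i) ∘ₗ LinearMap.adjoint (W i).toLinearMap := by
      refine LinearMap.ext fun v => ?_
      simp only [hW, LinearMap.sum_apply, LinearMap.comp_apply, map_sum]
    rw [this]
    exact sum_mem_iSup_blockSpace W ρ A
  · rintro _ ⟨A, rfl⟩
    change krausMap K _ = _
    rw [hW, hconj, hop]
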